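/- Let $(N_k)_{k\ge1}$ be a sequence of integers $N_k\ge 0$ and let $\xi_1,\xi_2,\dots$ be independent random variables with $$\mathbb P\{\xi_k=m\}=\frac1{2N_k+1},\qquad m\in\{-N_k,-N_k+1,\dots,N_k\}.$$ Put $S_n=\sum_{k=1}^n\xi_k$, $B_n\ge0$ with $B_n^2=\sum_{k=1}^n\mathrm{Var}(\xi_k)=\frac13\sum_{k=1}^nN_k(N_k+1)$, $\lambda_n=B_n\min_{1\le k\le n}N_k^{-1}$ and $$\Delta_n=\sup_{m\in\mathbb Z}\Big|B_n\,\mathbb P\{S_n=m\}-\frac1{\sqrt{2\pi}}\,e^{-m^2/(2B_n^2)}\Big| .$$ Here $N_k^{-1}=+\infty$ if $N_k=0$ (such $k$ do not contribute to the minimum), and $\lambda_n=0$ if $N_1=\dots=N_n=0$; when $B_n=0$, quotients by $B_n$ or $B_n^2$ are read as $0$. (a) The condition $\lim_n\lambda_n=\infty$ is necessary and sufficient for the central limit theorem, i.e. for the convergence in distribution of $S_n/B_n$ to the standard normal law. (b) The condition $\lim_n\lambda_n=\infty$ is necessary and sufficient for the local limit theorem, i.e. for $\Delta_n\to0$. (c)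 There is an absolute constant $C>0$ such that, for every such sequence and every $n\ge2$ with $\lambda_n\ge2$, one has $\Delta_n\le C\lambda_n^{-1}$. -/

import Mathlib

open MeasureTheory ProbabilityTheory Filter Topology
open scoped ENNReal

noncomputable section

namespace UniformLLT

variable {Ω : Type*} [MeasurableSpace Ω]

/-- The `ξ k` are independent and, for every `k`, `ξ k` is uniform on `{-N k, …, N k}`.
Sequences are indexed from `0`. -/
structure IsUniformSequence (P : Measure Ω) (N : ℕ → ℕ) (ξ : ℕ → Ω → ℤ) : Prop where
  measurable : ∀ k, Measurable (ξ k)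
  indep : iIndepFun ξ P
  law : ∀ k, ∀ m ∈ Set.Icc (-(N k : ℤ)) (N k : ℤ),
    P.real {ω | ξ k ω = m} = 1 / (2 * (N k : ℝ) + 1)

/-- The sum of the first `n` variables. -/
def partialSum (ξ : ℕ → Ω → ℤ) (n : ℕ) (ω : Ω) : ℤ := ∑ k ∈ Finset.range n, ξ k ω

/-- `M_n = E S_n`. -/
def meanSum (P : Measure Ω) (ξ : ℕ → Ω → ℤ) (n : ℕ) : ℝ :=
  ∫ ω, (partialSum ξ n ω : ℝ) ∂P

/-- `B_n`, the nonnegative square root of `B_n² = ∑ Var ξ_k`, over the first `n` variables. -/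
def normSum (P : Measure Ω) (ξ : ℕ → Ω → ℤ) (n : ℕ) : ℝ :=
  Real.sqrt (∑ k ∈ Finset.range n, Var[fun ω => (ξ k ω : ℝ); P])

/-- `λ_n = B_n · min N_k⁻¹`, over the first `n` indices. The minimum is taken in `[0, ∞]`, so that
`N_k⁻¹ = ∞` when `N_k = 0`: such an index does not contribute to the minimum. The product is always
finite (it is `0 · ∞ = 0` when all of the first `n` integers vanish). -/
def lam (P : Measure Ω) (N : ℕ → ℕ) (ξ : ℕ → Ω → ℤ) (n : ℕ) : ℝ :=
  (ENNReal.ofReal (normSum P ξ n) * ⨅ k ∈ Finset.range n, ((N k : ℝ≥0∞))⁻¹).toReal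

/-- `Δ_n = sup_m |B_n P(S_n = m) - (2π)^{-1/2} exp(-(m - M_n)² / (2 B_n²))|`, with `m` ranging
over the integers. -/
def Delta (P : Measure Ω) (ξ : ℕ → Ω → ℤ) (n : ℕ) : ℝ :=
  ⨆ m : ℤ, |normSum P ξ n * P.real {ω | partialSum ξ n ω = m}
    - 1 / Real.sqrt (2 * Real.pi)
      * Real.exp (-((m : ℝ) - meanSum P ξ n) ^ 2 / (2 * normSum P ξ n ^ 2))|

/-- The local limit theorem for integer valued summands: `Δ_n → 0`. -/
def SatisfiesLLT (P : Measure Ω) (ξ : ℕ → Ω → ℤ) : Prop :=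
  Tendsto (fun n => Delta P ξ n) atTop (𝓝 0)

/-- The central limit theorem: `(S_n - M_n) / B_n` converges in distribution to the standard
normal law. -/
def SatisfiesCLT (P : Measure Ω) [IsProbabilityMeasure P] (ξ : ℕ → Ω → ℤ) : Prop :=
  TendstoInDistribution
    (fun (n : ℕ) (ω : Ω) => ((partialSum ξ n ω : ℝ) - meanSum P ξ n) / normSum P ξ n) atTop
    (id : ℝ → ℝ) (fun _ => P) (gaussianReal 0 1)

end UniformLLT

end

/-!
Write `M` for the largest of `N_0, …, N_{n-1}`, so that `λ_n = B_n / M` (`lam_eq`), and let `φ_n` be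
the characteristic function of `S_n`, a product of Dirichlet kernels divided by their values at `0`
(`sumChar`, `dirMean`).

*Rate in the local limit theorem.* By Fourier inversion, `2 π (B P(S_n = m) - g(m / B))`, with
`B = B_n` and `g` the standard normal density, is the integral of
`exp (- i t m / B) (φ_n(t / B) - exp (-t² / 2))` over `|t| ≤ π B`, up to a Gaussian tail. Each factor
of `φ_n` satisfies `φ(s)² (1 + N (N + 1) s² / 16) ≤ 1` on `|s| ≤ π` (`dirMean_sq_mul_le`). Bernoulli's
inequality compares all factors with the one for `M`, and the product is therefore at most
`(1 + M (M + 1) s² / 16) ^ (-W / 2)` with `W = 3 B² / (M (M + 1)) ≥ 3 λ² / 2`. At `s = t / B` this is a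
polynomial decay in `t` that is uniform in the sequence and holds on the whole range of integration,
where separate factors would not be small enough (`sumChar_sq_mul_pow_le`). On the other hand a
Taylor expansion of the factors gives `|φ_n(t / B) - exp (-t² / 2)| ≤ 6 t⁴ / λ²`
(`abs_sumChar_sub_exp_le`). The geometric mean of the two bounds is integrable and of order `1 / λ`
once `λ² ≥ 8`; for smaller `λ` the decay alone suffices (`abs_charDiff_le`). Hence
`Δ_n ≤ C / λ_n` (`IsUniformSequence.Delta_le`).

*Sufficiency.* If `λ_n → ∞`, the rate yields the local limit theorem, and the bound `6 t⁴ / λ²` with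
the Lévy continuity theorem yields the central limit theorem.

*Necessity.* The uniform law on `{-M, …, M}` has a characteristic function that vanishes at
`2 π / (2 M + 1)`, so `φ_n(t / B_n)` vanishes at `t = τ_n = 2 π B_n / (2 M + 1) ≤ π λ_n`, while
`exp (-t² / 2)` has no zero. Under the central limit theorem, `φ_n(t / B_n) → exp (-t² / 2)`, and these
functions of `t` are Lipschitz with constant `1`, so that the `τ_n` cannot accumulate anywhere
(`IsUniformSequence.tendsto_lam_of_satisfiesCLT`). The local limit theorem first forces `B_n → ∞`. The
density of `(S_n + U) / B_n`, with `U` uniform on `[0, 1)` and independent of `S_n`, then converges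
pointwise to `g`, hence in `L¹` by Scheffé's lemma; its Fourier transform also vanishes at `τ_n`, so
`exp (-τ_n² / 2) → 0` (`IsUniformSequence.tendsto_lam_of_satisfiesLLT`).
-/

noncomputable section

namespace UniformLLT


/-! ### The characteristic function of a uniform variable -/

/-- The average of `cos (m s)` over the integers `|m| ≤ N`: the characteristic function at `s` of
the uniform law on `{-N, …, N}`, which is real by symmetry. -/
def dirMean (N : ℕ) (s : ℝ) : ℝ :=
  (∑ m ∈ Finset.Icc (-(N : ℤ)) N, Real.cos (m * s)) / (2 * N + 1)

lemma sum_Icc_symm_succ {E : Type*} [AddCommMonoid E] (N : ℕ) (f : ℤ → E) :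
    ∑ m ∈ Finset.Icc (-((N + 1 : ℕ) : ℤ)) ((N + 1 : ℕ) : ℤ), f m
      = (∑ m ∈ Finset.Icc (-(N : ℤ)) N, f m) + (f (N + 1) + f (-(N + 1))) := by
  have h : Finset.Icc (-((N + 1 : ℕ) : ℤ)) ((N + 1 : ℕ) : ℤ)
      = insert (-((N : ℤ) + 1)) (insert ((N : ℤ) + 1) (Finset.Icc (-(N : ℤ)) N)) := by
    ext x; simp only [Finset.mem_insert, Finset.mem_Icc]; push_cast; omega
  rw [h, Finset.sum_insert, Finset.sum_insert]
  · abel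
  · simp
  · simp only [Finset.mem_insert, Finset.mem_Icc]; omega

lemma sum_Icc_symm_sq (N : ℕ) :
    ∑ m ∈ Finset.Icc (-(N : ℤ)) N, (m : ℝ) ^ 2 = (N : ℝ) * (N + 1) / 3 * (2 * N + 1) := by
  induction N with
  | zero => simp
  | succ N ih => rw [sum_Icc_symm_succ, ih]; push_cast; ring

lemma card_Icc_symm (N : ℕ) : ((Finset.Icc (-(N : ℤ)) N).card : ℝ) = 2 * N + 1 := by
  rw [Int.card_Icc]
  have : ((N : ℤ) + 1 - -(N : ℤ)).toNat = 2 * N + 1 := by omega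
  rw [this]; push_cast; ring

/-- An average over `{-N, …, N}` inherits a bound that is quadratic in the point. -/
lemma avg_le_of_le_quadratic {N : ℕ} {f : ℤ → ℝ} {a b : ℝ}
    (h : ∀ m ∈ Finset.Icc (-(N : ℤ)) N, f m ≤ a + b * (m : ℝ) ^ 2) :
    (∑ m ∈ Finset.Icc (-(N : ℤ)) N, f m) / (2 * N + 1) ≤ a + b * (N * (N + 1) / 3) := by
  rw [div_le_iff₀ (by positivity)]
  refine (Finset.sum_le_sum h).trans (le_of_eq ?_)
  rw [Finset.sum_add_distrib, ← Finset.mul_sum, sum_Icc_symm_sq, Finset.sum_const, nsmul_eq_mul,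
    card_Icc_symm]
  ring

lemma dirMean_mul_sin (N : ℕ) (s : ℝ) :
    dirMean N s * (2 * N + 1) * Real.sin (s / 2) = Real.sin ((2 * N + 1) * s / 2) := by
  have hN : (2 * N + 1 : ℝ) ≠ 0 := by positivity
  rw [dirMean, div_mul_cancel₀ _ hN]
  clear hN
  induction N with
  | zero => simp
  | succ N ih =>
    rw [sum_Icc_symm_succ, add_mul, ih]
    push_cast
    rw [show -((N : ℝ) + 1) * s = -(((N : ℝ) + 1) * s) by ring, Real.cos_neg,
      show (2 * ((N : ℝ) + 1) + 1) * s / 2 = (N + 1) * s + s / 2 by ring,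
      show (2 * (N : ℝ) + 1) * s / 2 = (N + 1) * s - s / 2 by ring, Real.sin_add, Real.sin_sub]
    ring

lemma dirMean_neg (N : ℕ) (s : ℝ) : dirMean N (-s) = dirMean N s := by
  simp [dirMean, mul_neg, Real.cos_neg]

lemma dirMean_zero_left (s : ℝ) : dirMean 0 s = 1 := by simp [dirMean]

lemma dirMean_zero_right (N : ℕ) : dirMean N 0 = 1 := by
  have hN : (2 * N + 1 : ℝ) ≠ 0 := by positivity
  simp only [dirMean, mul_zero, Real.cos_zero, Finset.sum_const, nsmul_eq_mul, card_Icc_symm,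
    mul_one]
  exact div_self hN

lemma continuous_dirMean (N : ℕ) : Continuous (dirMean N) := by
  unfold dirMean; fun_prop

lemma abs_dirMean_le_one (N : ℕ) (s : ℝ) : |dirMean N s| ≤ 1 := by
  have hN : (0 : ℝ) < 2 * N + 1 := by positivity
  rw [dirMean, abs_div, abs_of_pos hN, div_le_one hN]
  refine (Finset.abs_sum_le_sum_abs _ _).trans ?_
  refine (Finset.sum_le_sum fun m _ => Real.abs_cos_le_one _).trans ?_
  rw [Finset.sum_const, nsmul_eq_mul, card_Icc_symm, mul_one]

/-- The first positive zero of the characteristic function of a nondegenerate uniform law. -/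
lemma dirMean_eq_zero {N : ℕ} (hN : 1 ≤ N) : dirMean N (2 * Real.pi / (2 * N + 1)) = 0 := by
  have hN' : (1 : ℝ) ≤ N := by exact_mod_cast hN
  have h := dirMean_mul_sin N (2 * Real.pi / (2 * N + 1))
  rw [show (2 * (N : ℝ) + 1) * (2 * Real.pi / (2 * N + 1)) / 2 = Real.pi by field_simp,
    Real.sin_pi] at h
  have h2 : 0 < Real.sin (2 * Real.pi / (2 * N + 1) / 2) := by
    apply Real.sin_pos_of_pos_of_lt_pi
    · positivity
    · rw [div_div, div_lt_iff₀ (by positivity)]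
      nlinarith [Real.pi_pos]
  have h3 : (0 : ℝ) < 2 * N + 1 := by positivity
  rcases mul_eq_zero.1 h with h | h
  · rcases mul_eq_zero.1 h with h | h
    · exact h
    · exact absurd h h3.ne'
  · exact absurd h h2.ne'

lemma dirMean_le {N : ℕ} {s : ℝ} (hs : N * |s| ≤ Real.pi) :
    dirMean N s ≤ 1 - 2 / Real.pi ^ 2 * s ^ 2 * (N * (N + 1) / 3) := by
  have := avg_le_of_le_quadratic (N := N) (f := fun m => Real.cos (m * s)) (a := 1)
    (b := -(2 / Real.pi ^ 2 * s ^ 2)) (fun m hm => by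
      rw [Finset.mem_Icc] at hm
      have hm' : |(m : ℝ)| ≤ N := by
        rw [abs_le]; exact ⟨by exact_mod_cast hm.1, by exact_mod_cast hm.2⟩
      have h1 : |(m : ℝ) * s| ≤ Real.pi := by
        rw [abs_mul]
        exact (mul_le_mul_of_nonneg_right hm' (abs_nonneg s)).trans hs
      have := Real.cos_le_one_sub_mul_cos_sq h1
      calc Real.cos (m * s) ≤ _ := this
        _ = _ := by ring)
  rw [dirMean]
  linarith

/-- On `|s| ≤ π` the characteristic function of the uniform law is at most
`(1 + N (N + 1) s² / 16)^{-1/2}`. Up to the first zero this is the parabola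
`cos x ≤ 1 - 2 x² / π²`, averaged; beyond it, the size `1 / ((2 N + 1) sin (s / 2))` of the
Dirichlet kernel. -/
lemma dirMean_sq_mul_le {N : ℕ} {s : ℝ} (hs : |s| ≤ Real.pi) :
    dirMean N s ^ 2 * (1 + N * (N + 1) * s ^ 2 / 16) ≤ 1 := by
  wlog h0 : 0 ≤ s generalizing s
  · have := this (s := -s) (by rwa [abs_neg]) (by linarith)
    rwa [dirMean_neg, neg_sq] at this
  rcases h0.eq_or_lt with rfl | h0
  · simp [dirMean_zero_right]
  rw [abs_of_pos h0] at hs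
  have hpi := Real.pi_pos
  have hpi2 : Real.pi ^ 2 ≤ 10 := by nlinarith [Real.pi_lt_d2]
  have hN : (0 : ℝ) ≤ N := by positivity
  have hD := dirMean_mul_sin N s
  have hsin : s / Real.pi ≤ Real.sin (s / 2) := by
    have := Real.mul_le_sin (x := s / 2) (by linarith) (by linarith)
    calc s / Real.pi = 2 / Real.pi * (s / 2) := by ring
      _ ≤ _ := this
  have hsin0 : 0 < Real.sin (s / 2) := lt_of_lt_of_le (by positivity) hsin
  set z : ℝ := (2 * N + 1) * s / 2 with hz
  have hzpos : 0 < z := by positivity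
  have hz2 : N * (N + 1) * s ^ 2 ≤ z ^ 2 := by rw [hz]; nlinarith [sq_nonneg s]
  rcases le_or_gt Real.pi z with hc | hc
  · have h1 : |dirMean N s| * (2 * z / Real.pi) ≤ 1 := by
      calc |dirMean N s| * (2 * z / Real.pi)
          = |dirMean N s| * (2 * N + 1) * (s / Real.pi) := by rw [hz]; ring
        _ ≤ |dirMean N s| * (2 * N + 1) * Real.sin (s / 2) := by gcongr
        _ = |dirMean N s * (2 * N + 1) * Real.sin (s / 2)| := by
            rw [abs_mul, abs_mul, abs_of_pos hsin0, abs_of_pos (by positivity : (0:ℝ) < 2 * N + 1)]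
        _ ≤ 1 := by rw [hD]; exact Real.abs_sin_le_one _
    have h2 : dirMean N s ^ 2 * (4 * z ^ 2 / Real.pi ^ 2) ≤ 1 := by
      have := pow_le_one₀ (n := 2) (by positivity) h1
      rw [mul_pow, sq_abs] at this
      calc _ = dirMean N s ^ 2 * (2 * z / Real.pi) ^ 2 := by ring
        _ ≤ 1 := this
    refine le_trans (mul_le_mul_of_nonneg_left ?_ (sq_nonneg _)) h2
    rw [le_div_iff₀ (by positivity)]
    have h3 : Real.pi ^ 2 ≤ z ^ 2 := by gcongr
    nlinarith [sq_nonneg z, mul_le_mul hz2 hpi2 (sq_nonneg _) (sq_nonneg _)]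
  · have hpos : 0 ≤ dirMean N s := by
      have h4 : 0 ≤ Real.sin z := Real.sin_nonneg_of_nonneg_of_le_pi hzpos.le hc.le
      rw [← hD, mul_assoc] at h4
      exact nonneg_of_mul_nonneg_left h4 (by positivity)
    have h5 := dirMean_le (N := N) (s := s) (by rw [abs_of_pos h0]; rw [hz] at hc; nlinarith)
    have h6 : (1 : ℝ) / 16 * (N * (N + 1) * s ^ 2)
        ≤ 2 / Real.pi ^ 2 * s ^ 2 * (N * (N + 1) / 3) := by
      calc (1 : ℝ) / 16 * (N * (N + 1) * s ^ 2)
          ≤ 2 / (3 * Real.pi ^ 2) * (N * (N + 1) * s ^ 2) := by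
            gcongr ?_ * _
            rw [div_le_div_iff₀ (by norm_num) (by positivity)]; linarith
        _ = _ := by field_simp
    have hq : 0 ≤ N * (N + 1) * s ^ 2 := by positivity
    have h7 : dirMean N s ≤ 1 - N * (N + 1) * s ^ 2 / 16 := by linarith
    generalize (N : ℝ) * (N + 1) * s ^ 2 = q at hq h7
    calc dirMean N s ^ 2 * (1 + q / 16) ≤ dirMean N s * (1 + q / 16) := by
          gcongr; nlinarith
      _ ≤ (1 - q / 16) * (1 + q / 16) := by gcongr
      _ ≤ 1 := by nlinarith [sq_nonneg q]

lemma abs_cos_sub_le (x : ℝ) : |Real.cos x - (1 - x ^ 2 / 2)| ≤ x ^ 4 := by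
  rcases le_or_gt |x| 1 with h | h
  · refine (Real.cos_bound h).trans ?_
    rw [show x ^ 4 = |x| ^ 4 by rw [← abs_pow, abs_of_nonneg (by positivity)]]
    have : 0 ≤ |x| ^ 4 := by positivity
    linarith
  · have h1 : 1 ≤ x ^ 2 := by rw [← sq_abs]; nlinarith
    rw [abs_le]
    constructor <;> nlinarith [Real.cos_le_one x, Real.one_sub_sq_div_two_le_cos (x := x)]

lemma abs_exp_neg_sub_le {x : ℝ} (hx : 0 ≤ x) : |Real.exp (-x) - (1 - x)| ≤ x ^ 2 := by
  have h1 := Real.add_one_le_exp (-x)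
  rw [abs_le]
  refine ⟨by nlinarith [sq_nonneg x], ?_⟩
  have h2 := Real.add_one_le_exp x
  have h3 : Real.exp (-x) ≤ 1 / (1 + x) := by
    rw [Real.exp_neg, ← one_div]
    exact one_div_le_one_div_of_le (by positivity) (by linarith)
  have h4 : 1 / (1 + x) ≤ 1 - x + x ^ 2 := by
    rw [div_le_iff₀ (by positivity)]
    nlinarith [pow_nonneg hx 3]
  linarith

/-- Comparison with the Gaussian of the same variance, with an error of fourth order. -/
lemma abs_dirMean_sub_exp_le (N : ℕ) (s : ℝ) :
    |dirMean N s - Real.exp (-(N * (N + 1) / 3 * s ^ 2 / 2))|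
      ≤ 2 * N ^ 2 * (N * (N + 1)) * s ^ 4 := by
  rcases Nat.eq_zero_or_pos N with rfl | hN
  · simp [dirMean_zero_left]
  have hN1 : (1 : ℝ) ≤ N := by exact_mod_cast hN
  have key : ∀ m ∈ Finset.Icc (-(N : ℤ)) N,
      |Real.cos (m * s) - (1 - (m * s) ^ 2 / 2)| ≤ N ^ 2 * s ^ 4 * m ^ 2 := by
    intro m hm
    rw [Finset.mem_Icc] at hm
    have hm' : |(m : ℝ)| ≤ N := by
      rw [abs_le]; exact ⟨by exact_mod_cast hm.1, by exact_mod_cast hm.2⟩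
    have hm2 : (m : ℝ) ^ 2 ≤ N ^ 2 := by rw [← sq_abs]; gcongr
    calc _ ≤ ((m : ℝ) * s) ^ 4 := abs_cos_sub_le _
      _ = (m : ℝ) ^ 2 * s ^ 4 * m ^ 2 := by ring
      _ ≤ _ := by gcongr
  have hup := avg_le_of_le_quadratic (N := N) (f := fun m => Real.cos (m * s)) (a := 1)
    (b := N ^ 2 * s ^ 4 - s ^ 2 / 2) (fun m hm => by
      have := (abs_le.1 (key m hm)).2
      calc _ ≤ _ := sub_le_iff_le_add.1 this
        _ = _ := by ring)
  have hlo := avg_le_of_le_quadratic (N := N) (f := fun m => -Real.cos (m * s)) (a := -1)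
    (b := N ^ 2 * s ^ 4 + s ^ 2 / 2) (fun m hm => by
      have := (abs_le.1 (key m hm)).1
      calc _ ≤ N ^ 2 * s ^ 4 * (m : ℝ) ^ 2 - (1 - (m * s) ^ 2 / 2) := by linarith
        _ = _ := by ring)
  rw [Finset.sum_neg_distrib, neg_div] at hlo
  change dirMean N s ≤ _ at hup
  change -dirMean N s ≤ _ at hlo
  have hx : (0 : ℝ) ≤ N * (N + 1) / 3 * s ^ 2 / 2 := by positivity
  have he := abs_le.1 (abs_exp_neg_sub_le hx)
  have e1 : (N * (N + 1) / 3 * s ^ 2 / 2 : ℝ) ^ 2 ≤ N ^ 2 * (N * (N + 1)) * s ^ 4 := by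
    have : (N + 1 : ℝ) ≤ 2 * N := by linarith
    calc (N * (N + 1) / 3 * s ^ 2 / 2 : ℝ) ^ 2
        = (N + 1) * (N * (N * (N + 1)) * s ^ 4) / 36 := by ring
      _ ≤ (2 * N) * (N * (N * (N + 1)) * s ^ 4) / 36 := by gcongr
      _ ≤ _ := by
        have : (0 : ℝ) ≤ N ^ 2 * (N * (N + 1)) * s ^ 4 := by positivity
        linarith
  have e2 : (0 : ℝ) ≤ N ^ 2 * (N * (N + 1)) * s ^ 4 := by positivity
  rw [abs_le]
  constructor <;> linarith


/-! ### Laws, moments and characteristic functions of the sums -/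

section Law

variable {Ω : Type*} [MeasurableSpace Ω] {P : Measure Ω} {N : ℕ → ℕ} {ξ : ℕ → Ω → ℤ}

lemma measurableSet_eq_int {X : Ω → ℤ} (hX : Measurable X) (m : ℤ) :
    MeasurableSet {ω | X ω = m} :=
  hX (measurableSet_singleton m)

/-- The point masses in `{-N_k, …, N_k}` already add up to `1`. -/
lemma IsUniformSequence.ae_mem [IsProbabilityMeasure P] (h : IsUniformSequence P N ξ) (k : ℕ) :
    ∀ᵐ ω ∂P, ξ k ω ∈ Finset.Icc (-(N k : ℤ)) (N k) := by
  have hm : MeasurableSet {ω | ξ k ω ∈ Finset.Icc (-(N k : ℤ)) (N k)} :=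
    h.measurable k (Finset.measurableSet _)
  have hU : {ω | ξ k ω ∈ Finset.Icc (-(N k : ℤ)) (N k)}
      = ⋃ m ∈ Finset.Icc (-(N k : ℤ)) (N k), {ω | ξ k ω = m} := by
    ext ω; simp
  have h1 : P.real {ω | ξ k ω ∈ Finset.Icc (-(N k : ℤ)) (N k)} = 1 := by
    rw [hU, measureReal_biUnion_finset]
    · rw [Finset.sum_congr rfl fun m hm => h.law k m (by simpa using hm), Finset.sum_const,
        nsmul_eq_mul, card_Icc_symm]
      have : (2 * (N k : ℝ) + 1) ≠ 0 := by positivity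
      field_simp
    · intro a _ b _ hab
      refine Set.disjoint_left.2 fun ω ha hb => hab ?_
      exact ha.symm.trans hb
    · exact fun m _ => measurableSet_eq_int (h.measurable k) m
  have h2 : P {ω | ξ k ω ∈ Finset.Icc (-(N k : ℤ)) (N k)} = 1 := by
    rwa [measureReal_def, ENNReal.toReal_eq_one_iff] at h1
  exact (mem_ae_iff_prob_eq_one hm).2 h2

lemma IsUniformSequence.integral_comp [IsProbabilityMeasure P] (h : IsUniformSequence P N ξ)
    {E : Type*} [NormedAddCommGroup E] [NormedSpace ℝ E] [CompleteSpace E] (k : ℕ) (f : ℤ → E) :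
    ∫ ω, f (ξ k ω) ∂P
      = (1 / (2 * (N k : ℝ) + 1)) • ∑ m ∈ Finset.Icc (-(N k : ℤ)) (N k), f m := by
  have hae : (fun ω => f (ξ k ω)) =ᵐ[P] fun ω => ∑ m ∈ Finset.Icc (-(N k : ℤ)) (N k),
      Set.indicator {ω | ξ k ω = m} (fun _ => f m) ω := by
    filter_upwards [h.ae_mem k] with ω hω
    rw [Finset.sum_eq_single_of_mem (ξ k ω) hω]
    · simp
    · intro b _ hb
      exact Set.indicator_of_notMem (fun h' : ξ k ω = b => hb h'.symm) _
  rw [integral_congr_ae hae, integral_finsetSum]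
  · rw [Finset.smul_sum]
    refine Finset.sum_congr rfl fun m hm => ?_
    rw [integral_indicator_const _ (measurableSet_eq_int (h.measurable k) m),
      h.law k m (by simpa using hm)]
  · exact fun m _ => (integrable_const _).indicator (measurableSet_eq_int (h.measurable k) m)

lemma sum_Icc_symm_eq_zero (N : ℕ) : ∑ m ∈ Finset.Icc (-(N : ℤ)) N, (m : ℝ) = 0 := by
  induction N with
  | zero => simp
  | succ N ih => rw [sum_Icc_symm_succ, ih]; push_cast; ring

lemma IsUniformSequence.integral_eq_zero [IsProbabilityMeasure P] (h : IsUniformSequence P N ξ)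
    (k : ℕ) : ∫ ω, (ξ k ω : ℝ) ∂P = 0 := by
  rw [h.integral_comp k (fun m => (m : ℝ)), sum_Icc_symm_eq_zero, smul_zero]

lemma IsUniformSequence.measurable_real (h : IsUniformSequence P N ξ) (k : ℕ) :
    Measurable fun ω => (ξ k ω : ℝ) :=
  (measurable_of_countable fun m : ℤ => (m : ℝ)).comp (h.measurable k)

lemma IsUniformSequence.measurable_partialSum (h : IsUniformSequence P N ξ) (n : ℕ) :
    Measurable (partialSum ξ n) :=
  Finset.measurable_fun_sum _ fun k _ => h.measurable k

lemma IsUniformSequence.integrable [IsProbabilityMeasure P] (h : IsUniformSequence P N ξ)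
    (k : ℕ) : Integrable (fun ω => (ξ k ω : ℝ)) P := by
  refine Integrable.of_bound (h.measurable_real k).aestronglyMeasurable (N k : ℝ) ?_
  filter_upwards [h.ae_mem k] with ω hω
  rw [Finset.mem_Icc] at hω
  rw [Real.norm_eq_abs, abs_le]
  exact ⟨by exact_mod_cast hω.1, by exact_mod_cast hω.2⟩

lemma IsUniformSequence.variance_eq [IsProbabilityMeasure P] (h : IsUniformSequence P N ξ)
    (k : ℕ) : Var[fun ω => (ξ k ω : ℝ); P] = N k * (N k + 1) / 3 := by
  rw [variance_of_integral_eq_zero (h.measurable_real k).aemeasurable (h.integral_eq_zero k)]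
  have hN : (2 * (N k : ℝ) + 1) ≠ 0 := by positivity
  have := h.integral_comp k (fun m => (m : ℝ) ^ 2)
  rw [sum_Icc_symm_sq] at this
  rw [show (∫ ω, (fun ω => (ξ k ω : ℝ)) ω ^ 2 ∂P) = _ from this, smul_eq_mul]
  field_simp

lemma IsUniformSequence.meanSum_eq_zero [IsProbabilityMeasure P] (h : IsUniformSequence P N ξ)
    (n : ℕ) : meanSum P ξ n = 0 := by
  simp only [meanSum, partialSum, Int.cast_sum]
  rw [integral_finsetSum _ fun k _ => h.integrable k]
  exact Finset.sum_eq_zero fun k _ => h.integral_eq_zero k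

lemma normSum_nonneg (n : ℕ) : 0 ≤ normSum P ξ n := Real.sqrt_nonneg _

lemma IsUniformSequence.normSum_sq [IsProbabilityMeasure P] (h : IsUniformSequence P N ξ)
    (n : ℕ) : normSum P ξ n ^ 2 = ∑ k ∈ Finset.range n, (N k * (N k + 1) / 3 : ℝ) := by
  rw [normSum, Real.sq_sqrt (Finset.sum_nonneg fun k _ => variance_nonneg _ _)]
  exact Finset.sum_congr rfl fun k _ => h.variance_eq k

lemma normSum_mono {m n : ℕ} (hmn : m ≤ n) : normSum P ξ m ≤ normSum P ξ n := by
  refine Real.sqrt_le_sqrt (Finset.sum_le_sum_of_subset_of_nonneg ?_ fun _ _ _ => variance_nonneg _ _)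
  exact Finset.range_mono hmn

/-- The largest of `N_0, …, N_{n-1}`. -/
def maxN (N : ℕ → ℕ) (n : ℕ) : ℕ := (Finset.range n).sup N

lemma le_maxN {n k : ℕ} (hk : k ∈ Finset.range n) : N k ≤ maxN N n :=
  Finset.le_sup (f := N) hk

lemma maxN_mono {m n : ℕ} (hmn : m ≤ n) : maxN N m ≤ maxN N n :=
  Finset.sup_mono (Finset.range_mono hmn)

lemma exists_eq_maxN {n : ℕ} (h : 1 ≤ maxN N n) : ∃ k ∈ Finset.range n, N k = maxN N n := by
  have hne : (Finset.range n).Nonempty := by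
    rw [Finset.nonempty_iff_ne_empty]
    intro h0
    rw [maxN, h0, Finset.sup_empty] at h
    exact absurd h (by simp)
  obtain ⟨k, hk, hk'⟩ := Finset.exists_mem_eq_sup _ hne N
  exact ⟨k, hk, hk'.symm⟩

lemma iInf_inv_eq_inv_maxN (N : ℕ → ℕ) (n : ℕ) :
    ⨅ k ∈ Finset.range n, ((N k : ℝ≥0∞))⁻¹ = (maxN N n : ℝ≥0∞)⁻¹ := by
  induction n with
  | zero => simp [maxN]
  | succ n ih =>
    have hs : maxN N (n + 1) = N n ⊔ maxN N n := by
      rw [maxN, Finset.range_add_one, Finset.sup_insert, ← maxN]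
    rw [Finset.range_add_one, Finset.iInf_insert, ih, hs]
    rcases le_total (N n) (maxN N n) with hle | hle
    · rw [sup_eq_right.2 hle]
      exact inf_eq_right.2 (ENNReal.inv_le_inv.2 (by exact_mod_cast hle))
    · rw [sup_eq_left.2 hle]
      exact inf_eq_left.2 (ENNReal.inv_le_inv.2 (by exact_mod_cast hle))

/-- The quotient is `0` when all `N_k` vanish, in agreement with the convention for `lam`. -/
lemma lam_eq (P : Measure Ω) (N : ℕ → ℕ) (ξ : ℕ → Ω → ℤ) (n : ℕ) :
    lam P N ξ n = normSum P ξ n / maxN N n := by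
  rw [lam, iInf_inv_eq_inv_maxN, ENNReal.toReal_mul, ENNReal.toReal_inv,
    ENNReal.toReal_ofReal (normSum_nonneg n), ENNReal.toReal_natCast, div_eq_mul_inv]

/-- The characteristic function of `S_n`: the product of those of the summands. It is real. -/
def sumChar (N : ℕ → ℕ) (n : ℕ) (s : ℝ) : ℝ := ∏ k ∈ Finset.range n, dirMean (N k) s

lemma continuous_sumChar (N : ℕ → ℕ) (n : ℕ) : Continuous (sumChar N n) :=
  continuous_finsetProd _ fun k _ => continuous_dirMean (N k)

/-- The zero of the factor with the largest `N_k` is a zero of the product. -/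
lemma sumChar_eq_zero {n : ℕ} (h : 1 ≤ maxN N n) :
    sumChar N n (2 * Real.pi / (2 * maxN N n + 1)) = 0 := by
  obtain ⟨k, hk, hk'⟩ := exists_eq_maxN h
  rw [sumChar]
  refine Finset.prod_eq_zero hk ?_
  rw [hk']
  exact dirMean_eq_zero h

lemma sum_Icc_symm_cexp (N : ℕ) (s : ℝ) :
    ∑ m ∈ Finset.Icc (-(N : ℤ)) N, Complex.exp (s * m * Complex.I)
      = ((∑ m ∈ Finset.Icc (-(N : ℤ)) N, Real.cos (m * s) : ℝ) : ℂ) := by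
  induction N with
  | zero => simp
  | succ N ih =>
    rw [sum_Icc_symm_succ, sum_Icc_symm_succ, ih]
    push_cast
    have h2 := Complex.two_cos (((N : ℂ) + 1) * s)
    rw [show (s : ℂ) * -(N + 1) * Complex.I = -((N + 1) * s) * Complex.I by ring,
      show (s : ℂ) * (N + 1) * Complex.I = ((N + 1) * s) * Complex.I by ring,
      show -((N : ℂ) + 1) * s = -((N + 1) * s) by ring, Complex.cos_neg, ← h2]
    ring

lemma IsUniformSequence.charFun_eq [IsProbabilityMeasure P] (h : IsUniformSequence P N ξ)
    (k : ℕ) (s : ℝ) : charFun (P.map fun ω => (ξ k ω : ℝ)) s = (dirMean (N k) s : ℂ) := by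
  rw [charFun_apply_real, integral_map (h.measurable_real k).aemeasurable (by fun_prop)]
  have := h.integral_comp k (fun m => Complex.exp (s * m * Complex.I))
  rw [sum_Icc_symm_cexp] at this
  calc _ = ∫ ω, Complex.exp (s * (ξ k ω : ℤ) * Complex.I) ∂P := by simp
    _ = _ := this
    _ = _ := by
      rw [dirMean, Complex.real_smul, ← Complex.ofReal_mul]
      congr 1; ring

lemma IsUniformSequence.charFun_partialSum [IsProbabilityMeasure P]
    (h : IsUniformSequence P N ξ) (n : ℕ) (s : ℝ) :
    charFun (P.map fun ω => (partialSum ξ n ω : ℝ)) s = (sumChar N n s : ℂ) := by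
  have hind : iIndepFun (fun k ω => (ξ k ω : ℝ)) P :=
    h.indep.comp (fun _ (m : ℤ) => (m : ℝ)) fun _ => measurable_of_countable _
  have := (hind.restrict (Finset.range n)).charFun_map_fun_finsetSum_eq_prod
    (fun k _ => (h.measurable_real k).aemeasurable)
  simp only [partialSum, Int.cast_sum]
  rw [this, Finset.prod_apply, sumChar, Complex.ofReal_prod]
  exact Finset.prod_congr rfl fun k _ => h.charFun_eq k s

/-- The characteristic function of the normalized sum. -/
lemma IsUniformSequence.charFun_normalized [IsProbabilityMeasure P]
    (h : IsUniformSequence P N ξ) (n : ℕ) (t : ℝ) :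
    charFun (P.map fun ω => ((partialSum ξ n ω : ℝ) - meanSum P ξ n) / normSum P ξ n) t
      = (sumChar N n (t / normSum P ξ n) : ℂ) := by
  have hm : Measurable fun ω => (partialSum ξ n ω : ℝ) :=
    (measurable_of_countable fun m : ℤ => (m : ℝ)).comp (h.measurable_partialSum n)
  rw [← h.charFun_partialSum, charFun_apply_real, charFun_apply_real,
    integral_map hm.aemeasurable (by fun_prop), integral_map ((hm.sub_const _).div_const _).aemeasurable (by fun_prop),
    h.meanSum_eq_zero]
  congr 1; ext ω
  congr 1
  push_cast
  ring

end Law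


/-! ### Bounds for the characteristic function of the sum -/

lemma abs_prod_sub_prod_le {ι : Type*} (s : Finset ι) {a b : ι → ℝ}
    (ha : ∀ i, |a i| ≤ 1) (hb : ∀ i, |b i| ≤ 1) :
    |∏ i ∈ s, a i - ∏ i ∈ s, b i| ≤ ∑ i ∈ s, |a i - b i| := by
  classical
  induction s using Finset.induction_on with
  | empty => simp
  | insert i s hi ih =>
    rw [Finset.prod_insert hi, Finset.prod_insert hi, Finset.sum_insert hi]
    have hp : |∏ j ∈ s, a j| ≤ 1 := by
      rw [Finset.abs_prod]
      exact Finset.prod_le_one (fun _ _ => abs_nonneg _) fun j _ => ha j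
    calc |a i * ∏ j ∈ s, a j - b i * ∏ j ∈ s, b j|
        = |(a i - b i) * ∏ j ∈ s, a j + b i * (∏ j ∈ s, a j - ∏ j ∈ s, b j)| := by
          congr 1; ring
      _ ≤ |a i - b i| * |∏ j ∈ s, a j| + |b i| * |∏ j ∈ s, a j - ∏ j ∈ s, b j| := by
          rw [← abs_mul, ← abs_mul]; exact abs_add_le _ _
      _ ≤ |a i - b i| * 1 + 1 * ∑ j ∈ s, |a j - b j| := by
          gcongr
          exact hb i
      _ = _ := by ring

lemma mul_succ_le_of_le {a b : ℕ} (h : a ≤ b) : (a * (a + 1) : ℝ) ≤ b * (b + 1) := by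
  have : (a : ℝ) ≤ b := by exact_mod_cast h
  gcongr

/-- By the Bernoulli inequality `(1 + x) ^ v ≤ 1 + v x` for `0 ≤ v ≤ 1`, the product of the bounds
of the factors is at most a power of the bound of the factor with the largest `N_k`. -/
lemma sumChar_sq_mul_rpow_le {N : ℕ → ℕ} {n : ℕ} {s : ℝ} (hM : 1 ≤ maxN N n)
    (hs : |s| ≤ Real.pi) :
    sumChar N n s ^ 2 * (1 + maxN N n * (maxN N n + 1) * s ^ 2 / 16) ^
      ((∑ k ∈ Finset.range n, (N k * (N k + 1) : ℝ)) / (maxN N n * (maxN N n + 1))) ≤ 1 := by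
  have hM' : (1 : ℝ) ≤ maxN N n := by exact_mod_cast hM
  have hA : (0 : ℝ) < maxN N n * (maxN N n + 1) := by positivity
  have hx : (0 : ℝ) ≤ maxN N n * (maxN N n + 1) * s ^ 2 / 16 := by positivity
  rw [Finset.sum_div, Real.rpow_sum_of_pos (by positivity), sumChar, ← Finset.prod_pow,
    ← Finset.prod_mul_distrib]
  refine Finset.prod_le_one (fun k _ => by positivity) fun k hk => ?_
  refine le_trans (mul_le_mul_of_nonneg_left ?_ (sq_nonneg _)) (dirMean_sq_mul_le (N := N k) hs)
  refine (rpow_one_add_le_one_add_mul_self (by linarith) (by positivity) ?_).trans (le_of_eq ?_)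
  · rw [div_le_one hA]; exact mul_succ_le_of_le (le_maxN hk)
  · field_simp

/-- Polynomial decay of the characteristic function of the normalized sum on the whole range of
integration, uniformly in the sequence. The power `p` may be as large as `3 λ² / 2`, which is at most
`W = 3 B² / (M (M + 1))`. -/
lemma sumChar_sq_mul_pow_le {N : ℕ → ℕ} {n p : ℕ} {B t : ℝ} (hM : 1 ≤ maxN N n) (hB : 0 < B)
    (hB2 : B ^ 2 = ∑ k ∈ Finset.range n, (N k * (N k + 1) / 3 : ℝ))
    (hp1 : 1 ≤ p) (hp : p ≤ 12) (hpB : 2 * p * (maxN N n : ℝ) ^ 2 ≤ 3 * B ^ 2)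
    (ht : |t| ≤ Real.pi * B) :
    sumChar N n (t / B) ^ 2 * (1 + t ^ 2 / 64) ^ p ≤ 1 := by
  have hM' : (1 : ℝ) ≤ maxN N n := by exact_mod_cast hM
  have hp1' : (1 : ℝ) ≤ p := by exact_mod_cast hp1
  have hp' : (p : ℝ) ≤ 12 := by exact_mod_cast hp
  have hs : |t / B| ≤ Real.pi := by
    rw [abs_div, abs_of_pos hB, div_le_iff₀ hB]; exact ht
  refine le_trans (mul_le_mul_of_nonneg_left ?_ (sq_nonneg _)) (sumChar_sq_mul_rpow_le hM hs)
  have hS : ∑ k ∈ Finset.range n, (N k * (N k + 1) : ℝ) = 3 * B ^ 2 := by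
    rw [hB2, ← Finset.sum_div]; ring
  rw [hS]
  set M : ℝ := (maxN N n : ℝ)
  have hA : 0 < M * (M + 1) := by positivity
  set W : ℝ := 3 * B ^ 2 / (M * (M + 1)) with hW
  have hWp : (p : ℝ) ≤ W := by
    rw [hW, le_div_iff₀ hA]
    nlinarith
  have hW0 : 0 < W := by positivity
  set x : ℝ := M * (M + 1) * (t / B) ^ 2 / 16 with hx
  have hx0 : 0 ≤ x := by positivity
  have hWx : W * x = 3 * t ^ 2 / 16 := by rw [hW, hx]; field_simp
  have h1 : 1 + t ^ 2 / 64 ≤ (1 + x) ^ (W / p) := by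
    refine le_trans ?_ (one_add_mul_self_le_rpow_one_add (by linarith) ?_)
    · rw [div_mul_eq_mul_div, hWx]
      have : t ^ 2 / 64 ≤ 3 * t ^ 2 / 16 / p := by
        rw [le_div_iff₀ (by linarith)]; nlinarith [sq_nonneg t]
      linarith
    · rw [le_div_iff₀ (by linarith)]; linarith
  calc (1 + t ^ 2 / 64) ^ p ≤ ((1 + x) ^ (W / p)) ^ p := by gcongr
    _ = (1 + x) ^ W := by
      rw [← Real.rpow_natCast, ← Real.rpow_mul (by positivity), div_mul_cancel₀ _ (by positivity)]

/-- The characteristic function of the normalized sum differs from that of the normal law by at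
most `6 t⁴ / λ²`. -/
lemma abs_sumChar_sub_exp_le {N : ℕ → ℕ} {n : ℕ} {B : ℝ} (hB : 0 < B)
    (hB2 : B ^ 2 = ∑ k ∈ Finset.range n, (N k * (N k + 1) / 3 : ℝ)) (t : ℝ) :
    |sumChar N n (t / B) - Real.exp (-(t ^ 2 / 2))| ≤ 6 * t ^ 4 / (B / maxN N n) ^ 2 := by
  have he : Real.exp (-(t ^ 2 / 2))
      = ∏ k ∈ Finset.range n, Real.exp (-((N k : ℝ) * (N k + 1) / 3 * (t / B) ^ 2 / 2)) := by
    rw [← Real.exp_sum, Finset.sum_neg_distrib, ← Finset.sum_div, ← Finset.sum_mul, ← hB2]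
    congr 2; field_simp
  rw [he, sumChar]
  refine (abs_prod_sub_prod_le _ (fun k => abs_dirMean_le_one _ _) fun k => ?_).trans ?_
  · rw [abs_of_pos (Real.exp_pos _), Real.exp_le_one_iff, neg_nonpos]; positivity
  calc ∑ k ∈ Finset.range n,
        |dirMean (N k) (t / B) - Real.exp (-((N k : ℝ) * (N k + 1) / 3 * (t / B) ^ 2 / 2))|
      ≤ ∑ k ∈ Finset.range n,
          6 * (maxN N n : ℝ) ^ 2 * (t / B) ^ 4 * ((N k : ℝ) * (N k + 1) / 3) := by
        refine Finset.sum_le_sum fun k hk => (abs_dirMean_sub_exp_le _ _).trans ?_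
        have : (N k : ℝ) ≤ maxN N n := by exact_mod_cast le_maxN hk
        calc 2 * (N k : ℝ) ^ 2 * (N k * (N k + 1)) * (t / B) ^ 4
            ≤ 2 * (maxN N n : ℝ) ^ 2 * (N k * (N k + 1)) * (t / B) ^ 4 := by gcongr
          _ = _ := by ring
    _ = 6 * t ^ 4 / (B / maxN N n) ^ 2 := by
        rw [← Finset.mul_sum, ← hB2, div_pow, div_pow, div_div_eq_mul_div]
        field_simp

/-- The integrand of the Fourier inversion formula for `B P(S_n = m) - g (m / B)`, without the
oscillating factor; `g` is the standard normal density. -/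
def charDiff (N : ℕ → ℕ) (n : ℕ) (B t : ℝ) : ℝ :=
  Set.indicator (Set.Ioc (-(Real.pi * B)) (Real.pi * B)) (fun t => sumChar N n (t / B)) t
    - Real.exp (-(t ^ 2 / 2))

lemma exp_neg_mul_pow_le (t : ℝ) {p : ℕ} (hp : p ≤ 12) :
    Real.exp (-(t ^ 2 / 2)) * (1 + t ^ 2 / 64) ^ p ≤ 1 := by
  have hp' : (p : ℝ) ≤ 12 := by exact_mod_cast hp
  have h1 : (1 + t ^ 2 / 64) ^ p ≤ Real.exp (t ^ 2 / 2) := by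
    calc (1 + t ^ 2 / 64) ^ p ≤ Real.exp (t ^ 2 / 64) ^ p := by
          gcongr; linarith [Real.add_one_le_exp (t ^ 2 / 64)]
      _ = Real.exp (p * (t ^ 2 / 64)) := by rw [← Real.exp_nat_mul]
      _ ≤ _ := by
        apply Real.exp_le_exp.2
        nlinarith [sq_nonneg t]
  calc _ ≤ Real.exp (-(t ^ 2 / 2)) * Real.exp (t ^ 2 / 2) := by gcongr
    _ = 1 := by rw [← Real.exp_add]; simp

/-- An integrable bound of order `1 / λ`. Where `λ² ≥ 8` it comes from multiplying the error
`t⁴ / λ²` with the decay `(1 + t²)⁻⁶`; for `λ² < 8` and for the Gaussian tail, decay alone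
suffices. -/
lemma abs_charDiff_le {N : ℕ → ℕ} {n : ℕ} {B : ℝ} (hM : 1 ≤ maxN N n) (hB : 0 < B)
    (hB2 : B ^ 2 = ∑ k ∈ Finset.range n, (N k * (N k + 1) / 3 : ℝ))
    (hlam : 2 ≤ B / maxN N n) (t : ℝ) :
    |charDiff N n B t| ≤ 256 / (B / maxN N n) * (1 + t ^ 2 / 64)⁻¹ := by
  have hM' : (1 : ℝ) ≤ maxN N n := by exact_mod_cast hM
  set l : ℝ := B / maxN N n with hl
  have hl0 : 0 < l := by linarith
  have hlB : l * maxN N n = B := by rw [hl]; field_simp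
  set h : ℝ := 1 + t ^ 2 / 64 with hh
  have hh1 : 1 ≤ h := by rw [hh]; nlinarith [sq_nonneg t]
  suffices hs : |charDiff N n B t| * l * h ≤ 256 by
    rw [div_mul_eq_mul_div, le_div_iff₀ hl0, ← div_eq_mul_inv, le_div_iff₀ (by linarith)]
    exact hs
  have hE := Real.exp_pos (-(t ^ 2 / 2))
  by_cases ht : t ∈ Set.Ioc (-(Real.pi * B)) (Real.pi * B)
  · have ht' : |t| ≤ Real.pi * B := abs_le.2 ⟨ht.1.le, ht.2⟩
    have hD : charDiff N n B t = sumChar N n (t / B) - Real.exp (-(t ^ 2 / 2)) := by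
      rw [charDiff, Set.indicator_of_mem ht]
    rw [hD]
    -- decay of both terms of the difference, with a power `q` that `W ≥ 2 q` allows
    have decay : ∀ q : ℕ, 1 ≤ q → q ≤ 6 → 4 * q * (maxN N n : ℝ) ^ 2 ≤ 3 * B ^ 2 →
        |sumChar N n (t / B) - Real.exp (-(t ^ 2 / 2))| * h ^ q ≤ 2 := by
      intro q hq1 hq6 hqB
      have h1 := sumChar_sq_mul_pow_le (p := 2 * q) hM hB hB2 (by omega) (by omega)
        (by push_cast; linarith) ht'
      have h2 : |sumChar N n (t / B)| * h ^ q ≤ 1 := by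
        refine abs_le_of_sq_le_sq' ?_ zero_le_one |>.2
        rw [mul_pow, sq_abs, ← pow_mul, mul_comm q, one_pow]
        exact h1
      have h3 := exp_neg_mul_pow_le t (p := q) (by omega)
      calc _ ≤ (|sumChar N n (t / B)| + |Real.exp (-(t ^ 2 / 2))|) * h ^ q := by
            gcongr; exact abs_sub _ _
        _ ≤ 2 := by rw [abs_of_pos hE, add_mul]; linarith
    rcases le_or_gt 8 (l ^ 2) with hc | hc
    · have h6 := decay 6 (by norm_num) le_rfl (by
        rw [← hlB]; push_cast; nlinarith [sq_nonneg (maxN N n : ℝ)])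
      have h4 := abs_sumChar_sub_exp_le hB hB2 t
      rw [← hl, le_div_iff₀ (by positivity)] at h4
      set D := |sumChar N n (t / B) - Real.exp (-(t ^ 2 / 2))|
      have hD0 : 0 ≤ D := abs_nonneg _
      have ht4 : t ^ 4 ≤ 4096 * h ^ 2 := by
        rw [hh]; nlinarith [sq_nonneg t]
      refine abs_le_of_sq_le_sq' ?_ (by norm_num) |>.2
      have hpow : h ^ 4 ≤ h ^ 6 := pow_le_pow_right₀ hh1 (by norm_num)
      calc (D * l * h) ^ 2 = (D * l ^ 2) * (D * h ^ 2) := by ring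
        _ ≤ (6 * (4096 * h ^ 2)) * (D * h ^ 2) := by
          exact mul_le_mul_of_nonneg_right (by linarith) (by positivity)
        _ = 24576 * (D * h ^ 4) := by ring
        _ ≤ 24576 * (D * h ^ 6) := by gcongr
        _ ≤ 256 ^ 2 := by linarith
    · have h3 := decay 3 (by norm_num) (by norm_num) (by
        have hl4 : 4 ≤ l ^ 2 := by nlinarith
        rw [← hlB, mul_pow]; push_cast
        linarith [mul_le_mul_of_nonneg_right hl4 (sq_nonneg (maxN N n : ℝ))])
      have hl3 : l ≤ 3 := by nlinarith
      set D := |sumChar N n (t / B) - Real.exp (-(t ^ 2 / 2))|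
      have hD0 : 0 ≤ D := abs_nonneg _
      have hpow : h ^ 1 ≤ h ^ 3 := pow_le_pow_right₀ hh1 (by norm_num)
      calc D * l * h = l * (D * h ^ 1) := by ring
        _ ≤ 3 * (D * h ^ 3) := by gcongr
        _ ≤ 256 := by linarith
  · have hD : |charDiff N n B t| = Real.exp (-(t ^ 2 / 2)) := by
      rw [charDiff, Set.indicator_of_notMem ht, zero_sub, abs_neg, abs_of_pos hE]
    have ht' : Real.pi * B ≤ |t| := by
      by_contra hcon
      have := abs_lt.1 (not_le.1 hcon)
      exact ht ⟨this.1, this.2.le⟩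
    have hlt : l ≤ |t| := by
      have : l ≤ B := by rw [hl]; exact div_le_self hB.le hM'
      nlinarith [Real.pi_gt_three]
    have hth : |t| ≤ 4 * h := by
      rw [hh, ← sq_abs]; nlinarith [sq_nonneg (|t| - 8)]
    have hexp := exp_neg_mul_pow_le t (p := 2) (by norm_num)
    rw [← hh] at hexp
    rw [hD]
    calc Real.exp (-(t ^ 2 / 2)) * l * h ≤ Real.exp (-(t ^ 2 / 2)) * (4 * h) * h := by
          gcongr; linarith
      _ = 4 * (Real.exp (-(t ^ 2 / 2)) * h ^ 2) := by ring
      _ ≤ 256 := by linarith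


/-! ### Fourier inversion and the local limit theorem with a rate -/

section Inversion

variable {Ω : Type*} [MeasurableSpace Ω] {P : Measure Ω} {N : ℕ → ℕ} {ξ : ℕ → Ω → ℤ}

lemma intervalIntegral_cexp_int (j : ℤ) :
    ∫ s in -Real.pi..Real.pi, Complex.exp ((j : ℂ) * Complex.I * (s : ℂ))
      = if j = 0 then 2 * (Real.pi : ℂ) else 0 := by
  split_ifs with hj
  · simp only [hj, Int.cast_zero, zero_mul, Complex.exp_zero, intervalIntegral.integral_const]
    rw [Complex.real_smul]
    push_cast
    ring
  · have hc : (j : ℂ) * Complex.I ≠ 0 := mul_ne_zero (by exact_mod_cast hj) Complex.I_ne_zero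
    rw [integral_exp_mul_complex hc, div_eq_zero_iff, sub_eq_zero]
    left
    rw [Complex.exp_eq_exp_iff_exists_int]
    exact ⟨j, by push_cast; ring⟩

/-- Fourier inversion for an integer valued random variable. -/
lemma intervalIntegral_cexp_mul_charFun [IsProbabilityMeasure P] {X : Ω → ℤ}
    (hX : Measurable X) (m : ℤ) :
    ∫ s in -Real.pi..Real.pi, Complex.exp (-(s * m * Complex.I))
        * charFun (P.map fun ω => (X ω : ℝ)) s
      = 2 * Real.pi * (P.real {ω | X ω = m} : ℂ) := by
  have hXr : Measurable fun ω => (X ω : ℝ) := (measurable_of_countable fun m : ℤ => (m : ℝ)).comp hX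
  have hXc : Measurable fun ω => (X ω : ℂ) := (measurable_of_countable fun m : ℤ => (m : ℂ)).comp hX
  have hint : ∀ s : ℝ, Complex.exp (-(s * m * Complex.I))
      * charFun (P.map fun ω => (X ω : ℝ)) s
      = ∫ ω, Complex.exp (((X ω - m : ℤ) : ℂ) * Complex.I * s) ∂P := by
    intro s
    rw [charFun_apply_real, integral_map hXr.aemeasurable (by fun_prop), ← integral_const_mul]
    congr 1; ext ω
    rw [← Complex.exp_add]
    congr 1
    push_cast
    ring
  simp_rw [hint]
  have hfin : IsFiniteMeasure (volume.restrict (Set.uIoc (-Real.pi) Real.pi)) := by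
    rw [Set.uIoc_of_le (by linarith [Real.pi_pos])]; infer_instance
  rw [intervalIntegral_integral_swap]
  · simp_rw [intervalIntegral_cexp_int, sub_eq_zero]
    have : (fun ω => if X ω = m then 2 * (Real.pi : ℂ) else 0)
        = Set.indicator {ω | X ω = m} fun _ => 2 * (Real.pi : ℂ) := by
      ext ω; simp [Set.indicator_apply]
    rw [this, integral_indicator_const _ (measurableSet_eq_int hX m), Complex.real_smul]
    ring
  · refine Integrable.of_bound (C := 1) ?_ (Eventually.of_forall fun z => le_of_eq ?_)
    · refine Measurable.aestronglyMeasurable ?_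
      simp only [Int.cast_sub]
      refine Complex.measurable_exp.comp (Measurable.mul (Measurable.mul_const
        (Measurable.sub_const ?_ _) _) ?_)
      · exact hXc.comp measurable_snd
      · exact Complex.measurable_ofReal.comp measurable_fst
    · have := Complex.norm_exp_ofReal_mul_I ((X z.2 - m : ℤ) * z.1)
      rw [← this]
      simp only [Function.uncurry]
      congr 2
      push_cast
      ring

/-- Fourier inversion for the standard normal density. -/
lemma integral_cexp_mul_exp_neg (x : ℝ) :
    ∫ t : ℝ, Complex.exp (-(t * x * Complex.I)) * (Real.exp (-(t ^ 2 / 2)) : ℂ)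
      = 2 * Real.pi * ((1 / Real.sqrt (2 * Real.pi) * Real.exp (-x ^ 2 / 2) : ℝ) : ℂ) := by
  have h := fourierIntegral_gaussian (b := 1 / 2) (by norm_num) (-x)
  have h2 : ((Real.pi : ℂ) / (1 / 2)) ^ (1 / 2 : ℂ) = (Real.sqrt (2 * Real.pi) : ℂ) := by
    rw [Real.sqrt_eq_rpow, Complex.ofReal_cpow (by positivity)]
    push_cast
    congr 1
    ring
  rw [h2] at h
  have h3 : (2 * Real.pi : ℝ) = Real.sqrt (2 * Real.pi) * Real.sqrt (2 * Real.pi) :=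
    (Real.mul_self_sqrt (by positivity)).symm
  have h4 : (2 * Real.pi : ℂ) = Real.sqrt (2 * Real.pi) * Real.sqrt (2 * Real.pi) := by
    exact_mod_cast h3
  have h5 : (Real.sqrt (2 * Real.pi) : ℂ) ≠ 0 := by
    have : Real.sqrt (2 * Real.pi) ≠ 0 := (Real.sqrt_pos.2 (by positivity)).ne'
    exact_mod_cast this
  have h6 : ∫ t : ℝ, Complex.exp (-(t * x * Complex.I)) * (Real.exp (-(t ^ 2 / 2)) : ℂ)
      = Real.sqrt (2 * Real.pi) * Complex.exp (-(-(x : ℂ)) ^ 2 / (4 * (1 / 2))) := by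
    rw [← h]
    congr 1; ext t
    push_cast
    congr 2 <;> ring
  rw [h6, h4]
  push_cast
  field_simp
  congr 1
  ring

lemma integrable_exp_neg_sq_div_two : Integrable fun t : ℝ => Real.exp (-(t ^ 2 / 2)) := by
  have := integrable_exp_neg_mul_sq (b := 1 / 2) (by norm_num)
  refine this.congr (Eventually.of_forall fun t => ?_)
  simp only
  congr 1; ring

lemma integrable_charDiff (N : ℕ → ℕ) (n : ℕ) (B : ℝ) : Integrable (charDiff N n B) := by
  refine Integrable.sub ?_ integrable_exp_neg_sq_div_two
  rw [integrable_indicator_iff measurableSet_Ioc]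
  have hc : Continuous fun t => sumChar N n (t / B) :=
    (continuous_sumChar N n).comp (continuous_id.div_const B)
  exact (hc.integrableOn_Icc).mono_set Set.Ioc_subset_Icc_self

lemma integrable_cexp_mul {f : ℝ → ℝ} (hf : Integrable f) (x : ℝ) :
    Integrable fun t : ℝ => Complex.exp (-(t * x * Complex.I)) * (f t : ℂ) := by
  refine hf.ofReal.bdd_mul (c := 1) (by fun_prop) (Eventually.of_forall fun t => le_of_eq ?_)
  have := Complex.norm_exp_ofReal_mul_I (-(t * x))
  rw [← this]
  congr 2; push_cast; ring

/-- The local error as a Fourier integral. -/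
lemma IsUniformSequence.integral_cexp_mul_charDiff [IsProbabilityMeasure P]
    (h : IsUniformSequence P N ξ) {n : ℕ} (hB : 0 < normSum P ξ n) (m : ℤ) :
    ∫ t : ℝ, Complex.exp (-(t * (m / normSum P ξ n : ℝ) * Complex.I))
        * (charDiff N n (normSum P ξ n) t : ℂ)
      = 2 * Real.pi * ((normSum P ξ n * P.real {ω | partialSum ξ n ω = m}
        - 1 / Real.sqrt (2 * Real.pi) * Real.exp (-(m / normSum P ξ n) ^ 2 / 2) : ℝ) : ℂ) := by
  set B := normSum P ξ n
  have hpi := Real.pi_pos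
  have hI : Integrable (Set.indicator (Set.Ioc (-(Real.pi * B)) (Real.pi * B))
      fun t => sumChar N n (t / B)) := by
    have := (integrable_charDiff N n B).add integrable_exp_neg_sq_div_two
    refine this.congr (Eventually.of_forall fun t => ?_)
    simp [charDiff]
  have h1 : ∫ t : ℝ, Complex.exp (-(t * (m / B : ℝ) * Complex.I))
      * ((Set.indicator (Set.Ioc (-(Real.pi * B)) (Real.pi * B))
        (fun t => sumChar N n (t / B)) t : ℝ) : ℂ)
      = B * (2 * Real.pi * (P.real {ω | partialSum ξ n ω = m} : ℂ)) := by
    rw [← intervalIntegral_cexp_mul_charFun (h.measurable_partialSum n) m]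
    set F : ℝ → ℂ := fun s => Complex.exp (-(s * m * Complex.I))
      * charFun (P.map fun ω => (partialSum ξ n ω : ℝ)) s with hF
    have e1 : ∀ t : ℝ, Complex.exp (-(t * (m / B : ℝ) * Complex.I))
        * ((Set.indicator (Set.Ioc (-(Real.pi * B)) (Real.pi * B))
          (fun t => sumChar N n (t / B)) t : ℝ) : ℂ)
        = Set.indicator (Set.Ioc (-(Real.pi * B)) (Real.pi * B))
          (fun t : ℝ => F (t / B)) t := by
      intro t
      by_cases ht : t ∈ Set.Ioc (-(Real.pi * B)) (Real.pi * B)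
      · rw [Set.indicator_of_mem ht, Set.indicator_of_mem ht]
        simp only [hF, h.charFun_partialSum]
        congr 3
        push_cast
        ring
      · rw [Set.indicator_of_notMem ht, Set.indicator_of_notMem ht]
        simp
    simp_rw [e1]
    rw [integral_indicator measurableSet_Ioc,
      ← intervalIntegral.integral_of_le (by nlinarith [mul_pos hpi hB]),
      intervalIntegral.integral_comp_div F hB.ne', neg_div, mul_div_cancel_right₀ _ hB.ne',
      Complex.real_smul]
  simp only [charDiff, Complex.ofReal_sub, mul_sub]
  rw [integral_sub (integrable_cexp_mul hI _) (integrable_cexp_mul integrable_exp_neg_sq_div_two _),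
    h1, integral_cexp_mul_exp_neg]
  push_cast
  ring

/-- The local limit theorem with the rate `1 / λ_n`. -/
theorem IsUniformSequence.Delta_le [IsProbabilityMeasure P] (h : IsUniformSequence P N ξ)
    {n : ℕ} (hlam : 2 ≤ lam P N ξ n) : Delta P ξ n ≤ 1024 / lam P N ξ n := by
  have hpi := Real.pi_pos
  rw [lam_eq] at hlam ⊢
  have hM : 1 ≤ maxN N n := by
    by_contra hcon
    have : maxN N n = 0 := by omega
    rw [this] at hlam
    norm_num at hlam
  have hM' : (1 : ℝ) ≤ maxN N n := by exact_mod_cast hM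
  have hB : 0 < normSum P ξ n := by
    rw [le_div_iff₀ (by linarith)] at hlam
    linarith
  set l := normSum P ξ n / maxN N n with hl
  have hl0 : 0 < l := by linarith
  have hint : ∫ t : ℝ, 256 / l * (1 + t ^ 2 / 64)⁻¹ = 2 * Real.pi * (1024 / l) := by
    rw [integral_const_mul]
    have := Measure.integral_comp_div (fun t : ℝ => (1 + t ^ 2)⁻¹) 8
    rw [integral_univ_inv_one_add_sq] at this
    rw [show (fun t : ℝ => (1 + t ^ 2 / 64)⁻¹) = fun t : ℝ => (1 + (t / 8) ^ 2)⁻¹ by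
      ext t; congr 2; ring, this]
    rw [abs_of_pos (by norm_num : (0 : ℝ) < 8), smul_eq_mul]
    ring
  have hintble : Integrable fun t : ℝ => 256 / l * (1 + t ^ 2 / 64)⁻¹ := by
    refine Integrable.const_mul ?_ _
    have := integrable_inv_one_add_sq.comp_div (R := 8) (by norm_num)
    refine this.congr (Eventually.of_forall fun t => ?_)
    simp only
    congr 2; ring
  refine Real.iSup_le (fun m => ?_) (by positivity)
  have key := h.integral_cexp_mul_charDiff hB m
  set B := normSum P ξ n
  have hm : -((m : ℝ) - meanSum P ξ n) ^ 2 / (2 * B ^ 2) = -(m / B) ^ 2 / 2 := by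
    rw [h.meanSum_eq_zero, sub_zero]; field_simp
  rw [hm]
  set d := B * P.real {ω | partialSum ξ n ω = m}
    - 1 / Real.sqrt (2 * Real.pi) * Real.exp (-(m / B) ^ 2 / 2)
  have h1 : 2 * Real.pi * |d| ≤ 2 * Real.pi * (1024 / l) := by
    calc 2 * Real.pi * |d| = ‖(2 * Real.pi * (d : ℂ) : ℂ)‖ := by
          rw [norm_mul, norm_mul, Complex.norm_real, Complex.norm_real, Real.norm_eq_abs,
            Real.norm_eq_abs, abs_of_pos hpi]
          simp
      _ = ‖∫ t : ℝ, Complex.exp (-(t * (m / B : ℝ) * Complex.I)) * (charDiff N n B t : ℂ)‖ := by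
          rw [key]
      _ ≤ ∫ t : ℝ, 256 / l * (1 + t ^ 2 / 64)⁻¹ := by
          refine norm_integral_le_of_norm_le hintble (Eventually.of_forall fun t => ?_)
          have e : ‖Complex.exp (-(t * (m / B : ℝ) * Complex.I))‖ = 1 := by
            have := Complex.norm_exp_ofReal_mul_I (-(t * (m / B)))
            rw [← this]
            congr 2; push_cast; ring
          rw [norm_mul, e, one_mul, Complex.norm_real, Real.norm_eq_abs]
          exact abs_charDiff_le hM hB (h.normSum_sq n) hlam t
      _ = _ := hint
  exact le_of_mul_le_mul_left h1 (by positivity)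

end Inversion


/-! ### The central limit theorem -/

section CLT

variable {Ω : Type*} [MeasurableSpace Ω] {P : Measure Ω} {N : ℕ → ℕ} {ξ : ℕ → Ω → ℤ}

/-- The Lévy continuity theorem for the normalized sums. -/
lemma IsUniformSequence.satisfiesCLT_iff [IsProbabilityMeasure P] (h : IsUniformSequence P N ξ) :
    SatisfiesCLT P ξ ↔ ∀ t : ℝ, Tendsto (fun n => sumChar N n (t / normSum P ξ n)) atTop
      (𝓝 (Real.exp (-(t ^ 2 / 2)))) := by
  have hm : ∀ n, AEMeasurable
      (fun ω => ((partialSum ξ n ω : ℝ) - meanSum P ξ n) / normSum P ξ n) P := fun n =>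
    ((((measurable_of_countable fun m : ℤ => (m : ℝ)).comp
      (h.measurable_partialSum n)).sub_const _).div_const _).aemeasurable
  have hg : ∀ t : ℝ, charFun ((gaussianReal 0 1).map id) t = (Real.exp (-(t ^ 2 / 2)) : ℂ) := by
    intro t
    rw [Measure.map_id, charFun_gaussianReal]
    push_cast
    congr 1
    simp
  have key : ∀ t : ℝ, Tendsto (fun n => (sumChar N n (t / normSum P ξ n) : ℂ)) atTop
      (𝓝 (Real.exp (-(t ^ 2 / 2)) : ℂ)) ↔ Tendsto (fun n => sumChar N n (t / normSum P ξ n)) atTop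
      (𝓝 (Real.exp (-(t ^ 2 / 2)))) := fun t => Filter.tendsto_ofReal_iff
  constructor
  · intro hC t
    have := ProbabilityMeasure.tendsto_iff_tendsto_charFun.1 hC.tendsto t
    simp only [ProbabilityMeasure.coe_mk, h.charFun_normalized, hg] at this
    exact (key t).1 this
  · intro hC
    refine ⟨hm, aemeasurable_id, ProbabilityMeasure.tendsto_iff_tendsto_charFun.2 fun t => ?_⟩
    simp only [ProbabilityMeasure.coe_mk, h.charFun_normalized, hg]
    exact (key t).2 (hC t)

lemma normSum_pos_of_lam_pos {n : ℕ} (hl : 0 < lam P N ξ n) : 0 < normSum P ξ n := by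
  refine (normSum_nonneg n).lt_of_ne fun h0 => ?_
  rw [lam_eq, ← h0, zero_div] at hl
  exact lt_irrefl _ hl

lemma IsUniformSequence.satisfiesCLT [IsProbabilityMeasure P] (h : IsUniformSequence P N ξ)
    (hl : Tendsto (fun n => lam P N ξ n) atTop atTop) : SatisfiesCLT P ξ := by
  refine h.satisfiesCLT_iff.2 fun t => ?_
  rw [tendsto_iff_dist_tendsto_zero]
  have h0 : Tendsto (fun n => 6 * t ^ 4 / lam P N ξ n ^ 2) atTop (𝓝 0) :=
    tendsto_const_nhds.div_atTop ((tendsto_pow_atTop two_ne_zero).comp hl)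
  refine squeeze_zero' (Eventually.of_forall fun _ => dist_nonneg) ?_ h0
  filter_upwards [hl.eventually_gt_atTop 0] with n hn
  rw [Real.dist_eq, lam_eq]
  exact abs_sumChar_sub_exp_le (normSum_pos_of_lam_pos hn) (h.normSum_sq n) t

lemma IsUniformSequence.integral_partialSum_sq [IsProbabilityMeasure P]
    (h : IsUniformSequence P N ξ) (n : ℕ) :
    ∫ ω, (partialSum ξ n ω : ℝ) ^ 2 ∂P = normSum P ξ n ^ 2 := by
  have hm : Measurable fun ω => (partialSum ξ n ω : ℝ) :=
    (measurable_of_countable fun m : ℤ => (m : ℝ)).comp (h.measurable_partialSum n)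
  have hL : ∀ k, MemLp (fun ω => (ξ k ω : ℝ)) 2 P := by
    intro k
    refine MemLp.of_bound (h.measurable_real k).aestronglyMeasurable (N k : ℝ) ?_
    filter_upwards [h.ae_mem k] with ω hω
    rw [Finset.mem_Icc] at hω
    rw [Real.norm_eq_abs, abs_le]
    exact ⟨by exact_mod_cast hω.1, by exact_mod_cast hω.2⟩
  have hind : iIndepFun (fun k ω => (ξ k ω : ℝ)) P :=
    h.indep.comp (fun _ (m : ℤ) => (m : ℝ)) fun _ => measurable_of_countable _
  have hv := IndepFun.variance_sum (μ := P) (s := Finset.range n) (X := fun k ω => (ξ k ω : ℝ))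
    (fun k _ => hL k) (fun i _ j _ hij => hind.indepFun hij)
  have hS : (∑ k ∈ Finset.range n, fun ω => (ξ k ω : ℝ)) = fun ω => (partialSum ξ n ω : ℝ) := by
    ext ω; simp [partialSum]
  rw [hS, variance_of_integral_eq_zero hm.aemeasurable (h.meanSum_eq_zero n)] at hv
  rw [hv, normSum, Real.sq_sqrt (Finset.sum_nonneg fun k _ => variance_nonneg _ _)]

lemma IsUniformSequence.integrable_partialSum_sq [IsProbabilityMeasure P]
    (h : IsUniformSequence P N ξ) {n : ℕ} (hB : 0 < normSum P ξ n) :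
    Integrable (fun ω => (partialSum ξ n ω : ℝ) ^ 2) P := by
  refine Integrable.of_integral_ne_zero ?_
  rw [h.integral_partialSum_sq]
  positivity

/-- The characteristic function of `S_n` is Lipschitz with constant `E |S_n| ≤ B_n`. -/
lemma IsUniformSequence.abs_sumChar_sub_le [IsProbabilityMeasure P]
    (h : IsUniformSequence P N ξ) {n : ℕ} (hB : 0 < normSum P ξ n) (a b : ℝ) :
    |sumChar N n a - sumChar N n b| ≤ |a - b| * normSum P ξ n := by
  have hm : Measurable fun ω => (partialSum ξ n ω : ℝ) :=
    (measurable_of_countable fun m : ℤ => (m : ℝ)).comp (h.measurable_partialSum n)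
  set B := normSum P ξ n with hBdef
  have hint : ∀ s : ℝ, Integrable
      (fun ω => Complex.exp (s * (partialSum ξ n ω : ℝ) * Complex.I)) P := by
    intro s
    refine Integrable.of_bound (C := 1) ?_ (Eventually.of_forall fun ω => le_of_eq ?_)
    · exact (by fun_prop : Measurable fun x : ℝ =>
        Complex.exp (s * x * Complex.I)).comp hm |>.aestronglyMeasurable
    · exact_mod_cast Complex.norm_exp_ofReal_mul_I (s * (partialSum ξ n ω : ℝ))
  have hχ : ∀ s : ℝ, (sumChar N n s : ℂ)
      = ∫ ω, Complex.exp (s * (partialSum ξ n ω : ℝ) * Complex.I) ∂P := by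
    intro s
    rw [← h.charFun_partialSum, charFun_apply_real, integral_map hm.aemeasurable (by fun_prop)]
  have hS2 := h.integral_partialSum_sq n
  have hI2 := h.integrable_partialSum_sq hB
  have hval : ∫ ω, |a - b| * ((B + (partialSum ξ n ω : ℝ) ^ 2 / B) / 2) ∂P = |a - b| * B := by
    rw [integral_const_mul, integral_div, integral_add (integrable_const _) (hI2.div_const _),
      integral_div, hS2, ← hBdef]
    simp only [integral_const, probReal_univ, smul_eq_mul, one_mul]
    congr 1
    field_simp
    ring
  rw [← hval, ← Real.norm_eq_abs, ← Complex.norm_real, Complex.ofReal_sub, hχ, hχ,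
    ← integral_sub (hint a) (hint b)]
  refine norm_integral_le_of_norm_le
    ((((integrable_const _).add (hI2.div_const _)).div_const _).const_mul _)
    (Eventually.of_forall fun ω => ?_)
  generalize (partialSum ξ n ω : ℝ) = x
  have e : Complex.exp (a * x * Complex.I) - Complex.exp (b * x * Complex.I)
      = Complex.exp ((b * x : ℝ) * Complex.I)
        * (Complex.exp (Complex.I * ((a - b) * x : ℝ)) - 1) := by
    rw [mul_sub, ← Complex.exp_add, mul_one]
    push_cast
    congr 2
    ring
  rw [e, norm_mul, Complex.norm_exp_ofReal_mul_I, one_mul]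
  refine Real.norm_exp_I_mul_ofReal_sub_one_le.trans ?_
  rw [Real.norm_eq_abs, abs_mul]
  gcongr
  have : B + x ^ 2 / B - 2 * |x| = (|x| - B) ^ 2 / B := by
    field_simp; rw [← sq_abs x]; ring
  have : 0 ≤ (|x| - B) ^ 2 / B := by positivity
  linarith

lemma IsUniformSequence.normSum_pos_iff [IsProbabilityMeasure P] (h : IsUniformSequence P N ξ)
    (n : ℕ) : 0 < normSum P ξ n ↔ 1 ≤ maxN N n := by
  constructor
  · intro hB
    by_contra hcon
    have h0 : maxN N n = 0 := by omega
    have h1 := h.normSum_sq n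
    rw [Finset.sum_eq_zero] at h1
    · exact hB.ne' (pow_eq_zero_iff two_ne_zero |>.1 h1)
    · intro k hk
      have := le_maxN (N := N) hk
      have : N k = 0 := by omega
      simp [this]
  · intro hM
    obtain ⟨k, hk, hk'⟩ := exists_eq_maxN hM
    refine (normSum_nonneg n).lt_of_ne fun h0 => ?_
    have h1 := h.normSum_sq n
    rw [← h0] at h1
    have h2 := (Finset.sum_eq_zero_iff_of_nonneg (fun k _ => by positivity)).1
      (h1.symm.trans (by norm_num)) k hk
    have h3 : (1 : ℝ) ≤ N k := by rw [hk']; exact_mod_cast hM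
    have : (0 : ℝ) < N k * (N k + 1) / 3 := by positivity
    linarith

/-- `S_n / B_n` has a characteristic function with a zero at `2 π B_n / (2 M + 1)`, which is at
most `π λ_n`. -/
lemma two_pi_div_mul_normSum_le (n : ℕ) (hM : 1 ≤ maxN N n) :
    2 * Real.pi / (2 * maxN N n + 1) * normSum P ξ n ≤ Real.pi * lam P N ξ n := by
  have hM' : (1 : ℝ) ≤ maxN N n := by exact_mod_cast hM
  have hB := normSum_nonneg (P := P) (ξ := ξ) n
  rw [lam_eq, mul_div_assoc', div_mul_eq_mul_div,
    div_le_div_iff₀ (by positivity) (by positivity)]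
  have : 0 ≤ Real.pi * normSum P ξ n := mul_nonneg Real.pi_pos.le hB
  nlinarith

/-- If `λ_n` stayed bounded along a subsequence, the zeros `2 π B_n / (2 M + 1)` of the
characteristic functions would accumulate at some `t`, and the limit would vanish there. -/
lemma IsUniformSequence.tendsto_lam_of_satisfiesCLT [IsProbabilityMeasure P]
    (h : IsUniformSequence P N ξ) (hC : SatisfiesCLT P ξ) :
    Tendsto (fun n => lam P N ξ n) atTop atTop := by
  rw [h.satisfiesCLT_iff] at hC
  obtain ⟨n₀, hn₀⟩ : ∃ n₀, 1 ≤ maxN N n₀ := by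
    by_contra! hcon
    have h1 : ∀ n, sumChar N n (1 / normSum P ξ n) = 1 := by
      intro n
      rw [sumChar]
      refine Finset.prod_eq_one fun k hk => ?_
      have := le_maxN (N := N) hk
      have := hcon n
      rw [show N k = 0 by omega, dirMean_zero_left]
    have h2 := hC 1
    simp only [h1] at h2
    have h3 := tendsto_nhds_unique h2 tendsto_const_nhds
    rw [Real.exp_eq_one_iff] at h3
    norm_num at h3
  have hM : ∀ n, n₀ ≤ n → 1 ≤ maxN N n := fun n hn => hn₀.trans (maxN_mono hn)
  by_contra hcon
  obtain ⟨c, hc⟩ : ∃ c, ∃ᶠ n in atTop, lam P N ξ n < c := by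
    rw [tendsto_atTop] at hcon
    push Not at hcon
    obtain ⟨c, hc⟩ := hcon
    exact ⟨c, hc⟩
  set τ : ℕ → ℝ := fun n => 2 * Real.pi / (2 * maxN N n + 1) * normSum P ξ n with hτ
  have hfreq : ∃ᶠ n in atTop, τ n ∈ Set.Icc 0 (Real.pi * c) := by
    refine (hc.and_eventually (eventually_ge_atTop n₀)).mono fun n hn => ⟨?_, ?_⟩
    · exact mul_nonneg (by positivity) (normSum_nonneg n)
    · refine (two_pi_div_mul_normSum_le n (hM n hn.2)).trans ?_
      exact mul_le_mul_of_nonneg_left hn.1.le Real.pi_pos.le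
  obtain ⟨t, -, ht⟩ := isCompact_Icc.exists_mapClusterPt_of_frequently hfreq
  have hE := Real.exp_pos (-(t ^ 2 / 2))
  have hev := (hC t).eventually_const_lt (half_lt_self hE)
  have hfr := ht.frequently (Metric.ball_mem_nhds t (half_pos hE))
  obtain ⟨n, ⟨hn1, hn2⟩, hn3⟩ :=
    (hfr.and_eventually hev).and_eventually (eventually_ge_atTop n₀) |>.exists
  have hB := (h.normSum_pos_iff n).2 (hM n hn3)
  have hz : sumChar N n (τ n / normSum P ξ n) = 0 := by
    rw [hτ]
    simp only
    rw [mul_div_cancel_right₀ _ hB.ne', sumChar_eq_zero (hM n hn3)]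
  have hL := h.abs_sumChar_sub_le hB (t / normSum P ξ n) (τ n / normSum P ξ n)
  rw [hz, sub_zero, ← sub_div, abs_div, abs_of_pos hB, div_mul_cancel₀ _ hB.ne'] at hL
  rw [dist_comm, Real.dist_eq] at hn1
  have := le_abs_self (sumChar N n (t / normSum P ξ n))
  linarith

end CLT


/-! ### Necessity in the local limit theorem -/

section LLT

variable {Ω : Type*} [MeasurableSpace Ω] {P : Measure Ω} {N : ℕ → ℕ} {ξ : ℕ → Ω → ℤ}

lemma IsUniformSequence.abs_le_Delta [IsProbabilityMeasure P] (h : IsUniformSequence P N ξ)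
    (n : ℕ) (m : ℤ) :
    |normSum P ξ n * P.real {ω | partialSum ξ n ω = m}
      - 1 / Real.sqrt (2 * Real.pi) * Real.exp (-(m : ℝ) ^ 2 / (2 * normSum P ξ n ^ 2))|
      ≤ Delta P ξ n := by
  have hB := normSum_nonneg (P := P) (ξ := ξ) n
  have hbdd : BddAbove (Set.range fun m : ℤ =>
      |normSum P ξ n * P.real {ω | partialSum ξ n ω = m}
      - 1 / Real.sqrt (2 * Real.pi)
        * Real.exp (-((m : ℝ) - meanSum P ξ n) ^ 2 / (2 * normSum P ξ n ^ 2))|) := by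
    refine ⟨normSum P ξ n * 1 + 1 / Real.sqrt (2 * Real.pi) * 1, ?_⟩
    rintro _ ⟨m, rfl⟩
    refine (abs_sub _ _).trans ?_
    rw [abs_of_nonneg (mul_nonneg hB measureReal_nonneg), abs_of_nonneg (by positivity)]
    gcongr
    · exact measureReal_le_one
    · rw [Real.exp_le_one_iff, neg_div, neg_nonpos]
      positivity
  have := le_ciSup hbdd m
  simpa only [Delta, h.meanSum_eq_zero, sub_zero] using this

lemma IsUniformSequence.measureReal_eq_zero [IsProbabilityMeasure P]
    (h : IsUniformSequence P N ξ) {n : ℕ} {m : ℤ} (hm : 3 * normSum P ξ n ^ 2 < m) :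
    P.real {ω | partialSum ξ n ω = m} = 0 := by
  have hae : ∀ᵐ ω ∂P, ¬ partialSum ξ n ω = m := by
    filter_upwards [ae_all_iff.2 h.ae_mem] with ω hω heq
    have h1 : (partialSum ξ n ω : ℝ) ≤ 3 * normSum P ξ n ^ 2 := by
      rw [h.normSum_sq, Finset.mul_sum, partialSum, Int.cast_sum]
      refine Finset.sum_le_sum fun k _ => ?_
      have h2 : (ξ k ω : ℝ) ≤ N k := by exact_mod_cast (Finset.mem_Icc.1 (hω k)).2
      nlinarith [sq_nonneg (N k : ℝ)]
    rw [heq] at h1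
    linarith
  have h0 : P {ω | partialSum ξ n ω = m} = 0 := by
    have := ae_iff.1 hae
    simpa using this
  rw [measureReal_def, h0, ENNReal.toReal_zero]

/-- A fixed integer beyond the supports of all `S_n` shows that the local limit theorem fails when
`B_n` stays bounded. -/
lemma IsUniformSequence.tendsto_normSum_of_satisfiesLLT [IsProbabilityMeasure P]
    (h : IsUniformSequence P N ξ) (hL : SatisfiesLLT P ξ) :
    Tendsto (fun n => normSum P ξ n) atTop atTop := by
  have hmono : Monotone fun n => normSum P ξ n := fun _ _ hmn => normSum_mono hmn
  rcases tendsto_atTop_of_monotone hmono with ht | ⟨l, hl⟩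
  · exact ht
  exfalso
  have hle : ∀ n, normSum P ξ n ≤ l := fun n => hmono.ge_of_tendsto hl n
  obtain ⟨m, hm⟩ := exists_int_gt (3 * l ^ 2)
  have hlow : ∀ n, 1 / Real.sqrt (2 * Real.pi)
      * Real.exp (-(m : ℝ) ^ 2 / (2 * normSum P ξ n ^ 2)) ≤ Delta P ξ n := by
    intro n
    have hB := normSum_nonneg (P := P) (ξ := ξ) n
    have h1 := h.abs_le_Delta n m
    have hsq : normSum P ξ n ^ 2 ≤ l ^ 2 := by have := hle n; gcongr
    rw [h.measureReal_eq_zero (by linarith), mul_zero, zero_sub,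
      abs_neg, abs_of_nonneg (by positivity)] at h1
    exact h1
  have hexp : Tendsto (fun n => -(m : ℝ) ^ 2 / (2 * normSum P ξ n ^ 2)) atTop
      (𝓝 (-(m : ℝ) ^ 2 / (2 * l ^ 2))) := by
    rcases eq_or_ne l 0 with rfl | hl0
    · have : ∀ n, normSum P ξ n = 0 := fun n => le_antisymm (hle n) (normSum_nonneg n)
      simp [this]
    · exact tendsto_const_nhds.div ((hl.pow 2).const_mul 2) (by positivity)
  have hlim := ((Real.continuous_exp.tendsto _).comp hexp).const_mul (1 / Real.sqrt (2 * Real.pi))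
  have hnonpos := le_of_tendsto_of_tendsto' hlim hL hlow
  have : 0 < 1 / Real.sqrt (2 * Real.pi) * Real.exp (-(m : ℝ) ^ 2 / (2 * l ^ 2)) := by positivity
  linarith

/-- The function equal to `P (X = m)` on `[m, m + 1)` is the density of `X + U` with `U` uniform on
`[0, 1)` and independent of `X`, so its Fourier transform is a multiple of that of `X`. -/
lemma integral_cexp_mul_measureReal_floor [IsProbabilityMeasure P] {X : Ω → ℤ}
    (hX : Measurable X) (s : ℝ) :
    Integrable (fun y : ℝ => Complex.exp (s * y * Complex.I) * (P.real {ω | X ω = ⌊y⌋} : ℂ)) ∧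
    ∫ y : ℝ, Complex.exp (s * y * Complex.I) * (P.real {ω | X ω = ⌊y⌋} : ℂ)
      = charFun (P.map fun ω => (X ω : ℝ)) s
        * ∫ u in Set.Ico (0 : ℝ) 1, Complex.exp (s * u * Complex.I) := by
  have hXr : Measurable fun ω => (X ω : ℝ) := (measurable_of_countable fun m : ℤ => (m : ℝ)).comp hX
  have hexp : Measurable fun y : ℝ => Complex.exp (s * y * Complex.I) := by fun_prop
  set G : ℝ → ℂ := Set.indicator (Set.Ico 0 1) fun u : ℝ => Complex.exp (s * u * Complex.I) with hG
  have hGm : Measurable G := hexp.indicator measurableSet_Ico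
  have hGi : Integrable G := by
    rw [hG, integrable_indicator_iff measurableSet_Ico]
    exact ((by fun_prop : Continuous fun u : ℝ => Complex.exp (s * u * Complex.I)).integrableOn_Icc
      (a := 0) (b := 1)).mono_set Set.Ico_subset_Icc_self
  set F : Ω × ℝ → ℂ := fun z => Complex.exp (s * (X z.1 : ℝ) * Complex.I) * G (z.2 - X z.1) with hF
  have hFm : AEStronglyMeasurable F (P.prod volume) := by
    refine Measurable.aestronglyMeasurable (Measurable.mul ?_ ?_)
    · exact hexp.comp (hXr.comp measurable_fst)
    · exact hGm.comp (measurable_snd.sub (hXr.comp measurable_fst))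
  have hnorm : ∀ x : ℝ, ‖Complex.exp (s * x * Complex.I)‖ = 1 := fun x => by
    exact_mod_cast Complex.norm_exp_ofReal_mul_I (s * x)
  have hFi : Integrable F (P.prod volume) := by
    rw [integrable_prod_iff hFm]
    refine ⟨Eventually.of_forall fun ω => ?_, ?_⟩
    · exact (hGi.comp_sub_right (X ω : ℝ)).const_mul (Complex.exp (s * (X ω : ℝ) * Complex.I))
    have : ∀ ω, ∫ y, ‖F (ω, y)‖ = ∫ u, ‖G u‖ := by
      intro ω
      simp only [hF, norm_mul, hnorm, one_mul]
      exact integral_sub_right_eq_self (fun u => ‖G u‖) (X ω : ℝ)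
    simp_rw [this]
    exact integrable_const _
  -- integrating out `ω` for a fixed `y`
  have hy : ∀ y : ℝ, ∫ ω, F (ω, y) ∂P
      = Complex.exp (s * y * Complex.I) * (P.real {ω | X ω = ⌊y⌋} : ℂ) := by
    intro y
    have : (fun ω => F (ω, y)) = Set.indicator {ω | X ω = ⌊y⌋}
        fun _ => Complex.exp (s * y * Complex.I) := by
      ext ω
      by_cases hω : X ω = ⌊y⌋
      · have hmem : y - X ω ∈ Set.Ico (0 : ℝ) 1 := by
          rw [hω]; exact ⟨by linarith [Int.floor_le y], by linarith [Int.lt_floor_add_one y]⟩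
        rw [Set.indicator_of_mem (show ω ∈ {ω | X ω = ⌊y⌋} from hω)]
        simp only [hF, hG]
        rw [Set.indicator_of_mem hmem, ← Complex.exp_add]
        congr 1
        push_cast
        ring
      · have hmem : y - X ω ∉ Set.Ico (0 : ℝ) 1 := by
          intro hm
          exact hω (Int.floor_eq_iff.2 ⟨by linarith [hm.1], by linarith [hm.2]⟩).symm
        rw [Set.indicator_of_notMem (show ω ∉ {ω | X ω = ⌊y⌋} from hω)]
        simp only [hF, hG]
        rw [Set.indicator_of_notMem hmem, mul_zero]
    rw [this, integral_indicator_const _ (measurableSet_eq_int hX _), Complex.real_smul, mul_comm]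
  -- integrating out `y` for a fixed `ω`
  have hω : ∀ ω, ∫ y, F (ω, y) = Complex.exp (s * (X ω : ℝ) * Complex.I)
      * ∫ u in Set.Ico (0 : ℝ) 1, Complex.exp (s * u * Complex.I) := by
    intro ω
    simp only [hF]
    rw [integral_const_mul, integral_sub_right_eq_self G (X ω : ℝ), hG,
      integral_indicator measurableSet_Ico]
  constructor
  · have := hFi.integral_prod_right
    simpa only [hy] using this
  · have := integral_integral_swap (f := fun ω y => F (ω, y)) hFi
    simp only [hy, hω] at this
    rw [← this, integral_mul_const, charFun_apply_real, integral_map hXr.aemeasurable (by fun_prop)]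

/-- The density, a step function, of `(S_n + U) / B_n` with `U` uniform on `[0, 1)` and independent
of `S_n`, for `B_n > 0`. -/
def stepDensity (P : Measure Ω) (ξ : ℕ → Ω → ℤ) (n : ℕ) (x : ℝ) : ℝ :=
  normSum P ξ n * P.real {ω | partialSum ξ n ω = ⌊normSum P ξ n * x⌋}

/-- The density of the standard normal law. -/
def normalDensity (x : ℝ) : ℝ := 1 / Real.sqrt (2 * Real.pi) * Real.exp (-(x ^ 2 / 2))

lemma integrable_normalDensity : Integrable normalDensity :=
  integrable_exp_neg_sq_div_two.const_mul _

lemma integral_cexp_mul_normalDensity (t : ℝ) :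
    ∫ x : ℝ, Complex.exp (t * x * Complex.I) * (normalDensity x : ℂ)
      = (Real.exp (-(t ^ 2 / 2)) : ℂ) := by
  have h := integral_cexp_mul_exp_neg (-t)
  have h3 : (2 * Real.pi : ℝ) = Real.sqrt (2 * Real.pi) * Real.sqrt (2 * Real.pi) :=
    (Real.mul_self_sqrt (by positivity)).symm
  have h5 : Real.sqrt (2 * Real.pi) ≠ 0 := (Real.sqrt_pos.2 (by positivity)).ne'
  calc ∫ x : ℝ, Complex.exp (t * x * Complex.I) * (normalDensity x : ℂ)
      = ∫ x : ℝ, ((1 / Real.sqrt (2 * Real.pi) : ℝ) : ℂ) *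
          (Complex.exp (-(x * (-t : ℝ) * Complex.I)) * (Real.exp (-(x ^ 2 / 2)) : ℂ)) := by
        congr 1; ext x
        rw [normalDensity, Complex.ofReal_mul, mul_left_comm]
        congr 3
        push_cast
        ring
    _ = (((1 / Real.sqrt (2 * Real.pi)) * ((2 * Real.pi) *
          (1 / Real.sqrt (2 * Real.pi) * Real.exp (-(-t) ^ 2 / 2))) : ℝ) : ℂ) := by
        rw [integral_const_mul, h]
        push_cast
        ring
    _ = _ := by
        congr 1
        rw [neg_sq, neg_div]
        nth_rewrite 2 [h3]
        field_simp

lemma integral_normalDensity : ∫ x, normalDensity x = 1 := by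
  have := integral_cexp_mul_normalDensity 0
  simp only [Complex.ofReal_zero, zero_mul, Complex.exp_zero, one_mul] at this
  rw [integral_complex_ofReal] at this
  have h2 : ∫ x, normalDensity x = Real.exp (-(0 ^ 2 / 2)) := by exact_mod_cast this
  rw [h2]; simp

lemma IsUniformSequence.integral_cexp_mul_stepDensity [IsProbabilityMeasure P]
    (h : IsUniformSequence P N ξ) {n : ℕ} (hB : 0 < normSum P ξ n) (s : ℝ) :
    Integrable (fun x : ℝ => Complex.exp ((s * normSum P ξ n : ℝ) * x * Complex.I)
      * (stepDensity P ξ n x : ℂ)) ∧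
    ∫ x : ℝ, Complex.exp ((s * normSum P ξ n : ℝ) * x * Complex.I) * (stepDensity P ξ n x : ℂ)
      = sumChar N n s * ∫ u in Set.Ico (0 : ℝ) 1, Complex.exp (s * u * Complex.I) := by
  obtain ⟨h1, h2⟩ := integral_cexp_mul_measureReal_floor (P := P) (h.measurable_partialSum n) s
  rw [h.charFun_partialSum] at h2
  set H : ℝ → ℂ := fun y =>
    Complex.exp (s * y * Complex.I) * (P.real {ω | partialSum ξ n ω = ⌊y⌋} : ℂ) with hH
  have e : (fun x : ℝ => Complex.exp ((s * normSum P ξ n : ℝ) * x * Complex.I)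
      * (stepDensity P ξ n x : ℂ)) = fun x => (normSum P ξ n : ℂ) * H (normSum P ξ n * x) := by
    ext x
    simp only [hH, stepDensity]
    push_cast
    rw [mul_left_comm]
    congr 3
    ring
  have hB' : (normSum P ξ n : ℂ) ≠ 0 := by exact_mod_cast hB.ne'
  rw [e]
  refine ⟨((integrable_comp_mul_left_iff H hB.ne').2 h1).const_mul _, ?_⟩
  rw [integral_const_mul, Measure.integral_comp_mul_left, abs_of_pos (inv_pos.2 hB),
    Complex.real_smul, ← mul_assoc, Complex.ofReal_inv, mul_inv_cancel₀ hB', one_mul, h2]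

lemma IsUniformSequence.integrable_stepDensity [IsProbabilityMeasure P]
    (h : IsUniformSequence P N ξ) {n : ℕ} (hB : 0 < normSum P ξ n) :
    Integrable (stepDensity P ξ n) ∧ ∫ x, stepDensity P ξ n x = 1 := by
  obtain ⟨h1, h2⟩ := h.integral_cexp_mul_stepDensity hB 0
  simp only [zero_mul, Complex.ofReal_zero, Complex.exp_zero, one_mul] at h1 h2
  have hs : sumChar N n 0 = 1 := Finset.prod_eq_one fun k _ => dirMean_zero_right _
  refine ⟨?_, ?_⟩
  · have := h1.re
    simpa using this
  · rw [integral_complex_ofReal, hs] at h2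
    have h3 : (∫ _ in Set.Ico (0 : ℝ) 1, (1 : ℂ)) = 1 := by simp
    rw [h3, mul_one] at h2
    exact_mod_cast h2

lemma IsUniformSequence.tendsto_stepDensity [IsProbabilityMeasure P]
    (h : IsUniformSequence P N ξ) (hL : SatisfiesLLT P ξ) (x : ℝ) :
    Tendsto (fun n => stepDensity P ξ n x) atTop (𝓝 (normalDensity x)) := by
  have hB := h.tendsto_normSum_of_satisfiesLLT hL
  have hfl : Tendsto (fun n => (⌊normSum P ξ n * x⌋ : ℝ) / normSum P ξ n) atTop (𝓝 x) := by
    have hinv : Tendsto (fun n => (normSum P ξ n)⁻¹) atTop (𝓝 0) := tendsto_inv_atTop_zero.comp hB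
    refine tendsto_of_tendsto_of_tendsto_of_le_of_le'
      (g := fun n => x - (normSum P ξ n)⁻¹) (h := fun _ => x) ?_ tendsto_const_nhds ?_ ?_
    · simpa using tendsto_const_nhds.sub hinv
    · filter_upwards [hB.eventually_gt_atTop 0] with n hn
      rw [le_div_iff₀ hn, sub_mul, inv_mul_cancel₀ hn.ne']
      linarith [Int.lt_floor_add_one (normSum P ξ n * x)]
    · filter_upwards [hB.eventually_gt_atTop 0] with n hn
      rw [div_le_iff₀ hn]
      linarith [Int.floor_le (normSum P ξ n * x)]
  have hcont : Continuous normalDensity := by unfold normalDensity; fun_prop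
  have h1 := (hcont.tendsto x).comp hfl
  have h2 : Tendsto (fun n => stepDensity P ξ n x
      - normalDensity ((⌊normSum P ξ n * x⌋ : ℝ) / normSum P ξ n)) atTop (𝓝 0) := by
    refine squeeze_zero_norm' ?_ hL
    filter_upwards [hB.eventually_gt_atTop 0] with n hn
    have := h.abs_le_Delta n ⌊normSum P ξ n * x⌋
    rw [Real.norm_eq_abs]
    refine le_trans (le_of_eq ?_) this
    rw [stepDensity, normalDensity]
    congr 4
    field_simp
  simpa using h2.add h1

/-- The lemma of Scheffé: pointwise convergence of probability densities implies convergence in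
`L¹`. -/
lemma tendsto_integral_abs_sub_of_densities {α : Type*} [MeasurableSpace α] {μ : Measure α}
    {f : ℕ → α → ℝ} {g : α → ℝ} (hg : Integrable g μ) (hg1 : ∫ x, g x ∂μ = 1)
    (hg0 : ∀ x, 0 ≤ g x) (hf0 : ∀ n x, 0 ≤ f n x)
    (hf : ∀ᶠ n in atTop, Integrable (f n) μ ∧ ∫ x, f n x ∂μ = 1)
    (hlim : ∀ x, Tendsto (fun n => f n x) atTop (𝓝 (g x))) :
    Tendsto (fun n => ∫ x, |g x - f n x| ∂μ) atTop (𝓝 0) := by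
  have h1 : Tendsto (fun n => ∫ x, max (g x - f n x) 0 ∂μ) atTop (𝓝 (∫ _, (0 : ℝ) ∂μ)) := by
    refine tendsto_integral_filter_of_dominated_convergence g ?_ ?_ hg ?_
    · filter_upwards [hf] with n hn
      exact (hg.sub hn.1).pos_part.aestronglyMeasurable
    · refine Eventually.of_forall fun n => Eventually.of_forall fun x => ?_
      rw [Real.norm_eq_abs, abs_of_nonneg (le_max_right _ _)]
      exact max_le (by linarith [hf0 n x]) (hg0 x)
    · refine Eventually.of_forall fun x => ?_
      have := ((tendsto_const_nhds (x := g x)).sub (hlim x)).max (tendsto_const_nhds (x := (0 : ℝ)))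
      simpa using this
  rw [integral_zero] at h1
  have h2 := h1.const_mul 2
  rw [mul_zero] at h2
  refine h2.congr' ?_
  filter_upwards [hf] with n hn
  have e : ∀ x, |g x - f n x| = 2 * max (g x - f n x) 0 - (g x - f n x) := by
    intro x
    rcases le_total (g x - f n x) 0 with hx | hx
    · rw [abs_of_nonpos hx, max_eq_right hx]; ring
    · rw [abs_of_nonneg hx, max_eq_left hx]; ring
  have hsub : Integrable (fun x => g x - f n x) μ := hg.sub hn.1
  simp_rw [e]
  rw [integral_sub (hsub.pos_part.const_mul 2) hsub, integral_const_mul,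
    integral_sub hg hn.1, hg1, hn.2]
  ring

/-- At `t = 2 π B_n / (2 M + 1)` the Fourier transform of the step density vanishes, hence
`exp (-t² / 2)` is at most the `L¹` distance to the normal density, which tends to `0`. As
`t ≤ π λ_n`, this forces `λ_n → ∞`. -/
lemma IsUniformSequence.tendsto_lam_of_satisfiesLLT [IsProbabilityMeasure P]
    (h : IsUniformSequence P N ξ) (hL : SatisfiesLLT P ξ) :
    Tendsto (fun n => lam P N ξ n) atTop atTop := by
  have hB := h.tendsto_normSum_of_satisfiesLLT hL
  have hS : Tendsto (fun n => ∫ x, |normalDensity x - stepDensity P ξ n x|) atTop (𝓝 0) := by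
    refine tendsto_integral_abs_sub_of_densities integrable_normalDensity integral_normalDensity
      (fun x => ?_) (fun n x => mul_nonneg (normSum_nonneg n) measureReal_nonneg) ?_
      (h.tendsto_stepDensity hL)
    · unfold normalDensity; positivity
    · filter_upwards [hB.eventually_gt_atTop 0] with n hn
      exact h.integrable_stepDensity hn
  by_contra hcon
  rw [tendsto_atTop] at hcon
  push Not at hcon
  obtain ⟨c, hc⟩ := hcon
  have hev := hS.eventually_lt_const (Real.exp_pos (-((Real.pi * c) ^ 2 / 2)))
  obtain ⟨n, ⟨hn1, hn2⟩, hn3⟩ :=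
    ((hc.and_eventually hev).and_eventually (hB.eventually_gt_atTop 0)).exists
  have hM := (h.normSum_pos_iff n).1 hn3
  set s : ℝ := 2 * Real.pi / (2 * maxN N n + 1) with hs
  have hs0 : 0 ≤ s * normSum P ξ n := by positivity
  have hsc : s * normSum P ξ n ≤ Real.pi * c :=
    (two_pi_div_mul_normSum_le n hM).trans (mul_le_mul_of_nonneg_left hn1.le Real.pi_pos.le)
  obtain ⟨i1, i2⟩ := h.integral_cexp_mul_stepDensity hn3 s
  rw [sumChar_eq_zero hM, Complex.ofReal_zero, zero_mul] at i2
  set t := s * normSum P ξ n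
  have hnorm : ∀ x : ℝ, ‖Complex.exp (t * x * Complex.I)‖ = 1 := fun x => by
    exact_mod_cast Complex.norm_exp_ofReal_mul_I (t * x)
  have i3 : Integrable fun x : ℝ => Complex.exp (t * x * Complex.I) * (normalDensity x : ℂ) :=
    integrable_normalDensity.ofReal.bdd_mul (c := 1) (by fun_prop)
      (Eventually.of_forall fun x => (hnorm x).le)
  have key : Real.exp (-(t ^ 2 / 2)) ≤ ∫ x, |normalDensity x - stepDensity P ξ n x| := by
    calc Real.exp (-(t ^ 2 / 2))
        = ‖∫ x : ℝ, Complex.exp (t * x * Complex.I)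
            * ((normalDensity x - stepDensity P ξ n x : ℝ) : ℂ)‖ := by
          simp only [Complex.ofReal_sub, mul_sub]
          rw [integral_sub i3 i1, i2, sub_zero, integral_cexp_mul_normalDensity, Complex.norm_real,
            Real.norm_eq_abs, abs_of_pos (Real.exp_pos _)]
      _ ≤ ∫ x : ℝ, ‖Complex.exp (t * x * Complex.I)
            * ((normalDensity x - stepDensity P ξ n x : ℝ) : ℂ)‖ := norm_integral_le_integral_norm _
      _ = _ := by
          simp only [norm_mul, hnorm, one_mul, Complex.norm_real, Real.norm_eq_abs]
  have hmono : Real.exp (-((Real.pi * c) ^ 2 / 2)) ≤ Real.exp (-(t ^ 2 / 2)) := by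
    apply Real.exp_le_exp.2
    have : t ^ 2 ≤ (Real.pi * c) ^ 2 := by gcongr
    linarith
  linarith

lemma IsUniformSequence.satisfiesLLT [IsProbabilityMeasure P] (h : IsUniformSequence P N ξ)
    (hl : Tendsto (fun n => lam P N ξ n) atTop atTop) : SatisfiesLLT P ξ := by
  refine squeeze_zero' (Eventually.of_forall fun n => Real.iSup_nonneg fun _ => abs_nonneg _) ?_
    (tendsto_const_nhds.div_atTop hl : Tendsto (fun n => 1024 / lam P N ξ n) atTop (𝓝 0))
  filter_upwards [hl.eventually_ge_atTop 2] with n hn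
  exact h.Delta_le hn

end LLT

end UniformLLT

end

theorem mainTheorem6 :
    (∀ (Ω : Type*) [MeasurableSpace Ω] (P : Measure Ω) [IsProbabilityMeasure P]
      (N : ℕ → ℕ) (ξ : ℕ → Ω → ℤ), UniformLLT.IsUniformSequence P N ξ →
        (Tendsto (fun n => UniformLLT.lam P N ξ n) atTop atTop ↔ UniformLLT.SatisfiesCLT P ξ) ∧
        (Tendsto (fun n => UniformLLT.lam P N ξ n) atTop atTop ↔ UniformLLT.SatisfiesLLT P ξ)) ∧
    (∃ C : ℝ, 0 < C ∧
      ∀ (Ω : Type*) [MeasurableSpace Ω] (P : Measure Ω) [IsProbabilityMeasure P]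
        (N : ℕ → ℕ) (ξ : ℕ → Ω → ℤ), UniformLLT.IsUniformSequence P N ξ →
          ∀ n : ℕ, 2 ≤ n → 2 ≤ UniformLLT.lam P N ξ n →
            UniformLLT.Delta P ξ n ≤ C / UniformLLT.lam P N ξ n) := by
  refine ⟨fun Ω _ P _ N ξ h => ⟨⟨h.satisfiesCLT, h.tendsto_lam_of_satisfiesCLT⟩,
    ⟨h.satisfiesLLT, h.tendsto_lam_of_satisfiesLLT⟩⟩, 1024, by norm_num, ?_⟩
  intro Ω _ P _ N ξ h n _ hlam
  exact h.Delta_le hlam
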